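/- Let $n\ge 2$ be an integer, $\frac34<a\le 1$ and $b=\frac12$, let $c>0$, and let $0<c_0\le 1$. For $k\in\mathbb{N}$ put $R_k=2^k$, $$D_k=R_k^{\frac{n-(n-1)a+nb}{n+1}},\qquad Q_k=R_k^{\frac{n-1}{n+1}(2a-b-1)}.$$ For integers $p_1,\dots,p_n$ and $q\ge 1$, call $(p_1/q,\dots,p_n/q)$ an admissible fraction if $\gcd(p_1,q)=1$ and, for every $2\le j\le n$, $p_j$ is even when $q\equiv 0 \pmod 4$ and odd when $q\equiv 2\pmod 4$ (no condition on $p_j$ when $q$ is odd). Let $F_k\subset\mathbb{R}^n$ be the union of all closed axis-parallel boxes (slabs) with side lengths $cR_k^{-1/2}\times cR_k^{-1}\times\cdots\times cR_k^{-1}$ centered at the points $$\Big(\frac{2p_1R_k}{qD_k^2},\frac{p_2}{D_kq},\dots,\frac{p_n}{D_kq}\Big),$$ where $(p_1/q,\dots,p_n/q)$ ranges over the admissible fractions with $1\le q\le Q_k$, and let $$F=\limsup_{k\to\infty}F_k=\bigcap_{N\ge 1}\bigcup_{k\ge N}F_k$$ be the corresponding $(a,b)$-set of divergence (a divergence set of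 type II). Then the Hausdorff dimension of $F\cap[0,c_0]^n$ satisfies $$\dim\big(F\cap[0,c_0]^n\big)\ \ge\ \alpha:=1+(n-1)a .$$ -/

import Mathlib

noncomputable section

namespace SchrodingerDivergence

/-- The dyadic scale `R_k = 2 ^ k`. -/
def scaleR (k : ℕ) : ℝ := 2 ^ k

/-- `D_k = R_k ^ ((n - (n - 1) a + n b) / (n + 1))`. -/
def scaleD (n : ℕ) (a b : ℝ) (k : ℕ) : ℝ :=
  scaleR k ^ (((n : ℝ) - ((n : ℝ) - 1) * a + (n : ℝ) * b) / ((n : ℝ) + 1))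

/-- `Q_k = R_k ^ ((n - 1) / (n + 1) * (2 a - b - 1))`. -/
def scaleQ (n : ℕ) (a b : ℝ) (k : ℕ) : ℝ :=
  scaleR k ^ (((n : ℝ) - 1) / ((n : ℝ) + 1) * (2 * a - b - 1))

/-- `(p_1 / q, …, p_n / q)` is an admissible fraction: `p_1` is coprime to `q`, and for `j ≥ 2`
the integer `p_j` is arbitrary if `q` is odd, even if `q ≡ 0 mod 4`, odd if `q ≡ 2 mod 4`.
The first coordinate is the index `0` of `Fin n`. -/
def IsAdmissible {n : ℕ} (p : Fin n → ℤ) (q : ℤ) : Prop :=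
  (∀ i : Fin n, (i : ℕ) = 0 → IsCoprime (p i) q) ∧
  (∀ j : Fin n, (j : ℕ) ≠ 0 → (q ≡ 0 [ZMOD 4] → Even (p j)) ∧ (q ≡ 2 [ZMOD 4] → Odd (p j)))

/-- The center `(2 p_1 R_k / (q D_k ^ 2), p_2 / (D_k q), …, p_n / (D_k q))` of a slab. -/
def slabCenter (n : ℕ) (a b : ℝ) (k : ℕ) (p : Fin n → ℤ) (q : ℤ) : EuclideanSpace ℝ (Fin n) :=
  WithLp.toLp 2 fun i =>
    if (i : ℕ) = 0 then 2 * (p i : ℝ) * scaleR k / ((q : ℝ) * scaleD n a b k ^ 2)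
    else (p i : ℝ) / (scaleD n a b k * (q : ℝ))

/-- The closed axis-parallel box with center `z` and side lengths
`c R_k ^ (-1/2), c R_k ^ (-1), …, c R_k ^ (-1)`. -/
def slab (n : ℕ) (c : ℝ) (k : ℕ) (z : EuclideanSpace ℝ (Fin n)) :
    Set (EuclideanSpace ℝ (Fin n)) :=
  {x | ∀ i : Fin n,
    |x i - z i| ≤ (if (i : ℕ) = 0 then c * scaleR k ^ (-(1 / 2) : ℝ) else c * (scaleR k)⁻¹) / 2}

/-- The collection `𝒜_k` of slabs centered at the points given by admissible fractions
with denominator `1 ≤ q ≤ Q_k`. -/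
def slabs (n : ℕ) (a b c : ℝ) (k : ℕ) : Set (Set (EuclideanSpace ℝ (Fin n))) :=
  {s | ∃ (p : Fin n → ℤ) (q : ℤ), 1 ≤ q ∧ (q : ℝ) ≤ scaleQ n a b k ∧ IsAdmissible p q ∧
    s = slab n c k (slabCenter n a b k p q)}

/-- `F_k`, the union of the slabs in `𝒜_k`. -/
def levelSet (n : ℕ) (a b c : ℝ) (k : ℕ) : Set (EuclideanSpace ℝ (Fin n)) :=
  ⋃ s ∈ slabs n a b c k, s

/-- The `(a, b)`-set of divergence `F = limsup F_k = ⋂_N ⋃_{k ≥ N} F_k`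
(it does not depend on the index at which the sequence starts). -/
def divergenceSet (n : ℕ) (a b c : ℝ) : Set (EuclideanSpace ℝ (Fin n)) :=
  ⋂ N : ℕ, ⋃ k ≥ N, levelSet n a b c k

/-- The cube `[0, c₀]^n`. -/
def cube (n : ℕ) (c₀ : ℝ) : Set (EuclideanSpace ℝ (Fin n)) :=
  {x | ∀ i : Fin n, x i ∈ Set.Icc 0 c₀}

end SchrodingerDivergence

end

/-!
Fix a scale `R = R_k` and write `D = D_k`, `Q = Q_k`. Only prime denominators `q ∈ (Q_{k-1}, Q_k]`
are used. For each of them there is a product density `slabDensity`, carried by the slabs with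
denominator `q`: in the first coordinate a sum of periodic tents at the fractions with numerator
prime to `q`, bounded because `Q * D ^ 2 = R ^ (3 / 2)` makes the slabs of one denominator fill a
positive proportion of each line in that direction; in the others a comb of tents of width `≈ R⁻¹`
and spacing `(q * D)⁻¹`. Let `g_k` be the average of these densities over `q`.

Two properties of `g_k` matter.

* Equidistribution (`tendsto_integral_mul_average`): the factors of `slabDensity` are periodic of
  mean one with periods tending to zero, so `g_k ⊗ g_k` converges weakly to `1`.
* Small correlations (`setIntegral_average_slabDensity_le`): the pairs of points at distance at most
  `ρ` have `g_k ⊗ g_k`-mass `O(ρ ^ (1 + (n - 1) * a - ε))`, uniformly in `k` and `ρ`. For two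
  distinct primes `p / q - p' / q'` takes each value in `ℤ / (q * q')` once per period, and the
  coincidences cost `1 / (Q ^ 2 * D) ≤ R ^ (-a)` in each of the last `n - 1` coordinates. A single
  prime is worse, but equal pairs are rare: `Q * (Q * D) ^ (n - 1) = R ^ ((n - 1) * a)` is what is
  needed, provided that the number of primes is at least `Q ^ (1 - ε)`. That holds for infinitely
  many `k` by Chebyshev's bound (`frequently_rpow_le_card_primesIoc`), which suffices for an upper
  limit of sets.

Starting from a density on the cube, multiply successively by `g_k` for a sparse sequence of `k`.
The correlation bound at a fixed finite set of scales survives by equidistribution, and at smaller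
scales by the uniform bound for `g_k`, with a slightly smaller exponent
(`IsCorrelationDensity.exists_mul`). The supports decrease to a compact subset of the divergence
set, and an energy argument bounds its dimension from below
(`hausdorffMeasure_iInter_ne_zero_of_correlation`).
-/

open MeasureTheory Filter Topology Set
open scoped ENNReal NNReal

namespace SchrodingerDivergence

/-! ### Hausdorff dimension from correlations -/

/-- The set of pairs of points at distance less than `2 * 2 ^ (-m)`. -/
def nearPairs (X : Type*) [PseudoEMetricSpace X] (m : ℕ) : Set (X × X) :=
  {p | edist p.1 p.2 < 2 * (2 : ℝ≥0∞) ^ (-(m : ℝ))}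

lemma isOpen_nearPairs (X : Type*) [PseudoEMetricSpace X] (m : ℕ) : IsOpen (nearPairs X m) :=
  isOpen_lt (continuous_fst.edist continuous_snd) continuous_const

lemma eball_prod_subset_nearPairs {X : Type*} [PseudoEMetricSpace X] (x : X) (m : ℕ) :
    Metric.eball x ((2 : ℝ≥0∞) ^ (-(m : ℝ))) ×ˢ Metric.eball x ((2 : ℝ≥0∞) ^ (-(m : ℝ)))
      ⊆ nearPairs X m := by
  rintro ⟨y, z⟩ ⟨hy, hz⟩
  simp only [Metric.mem_eball] at hy hz
  have h := edist_triangle_right y z x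
  simp only [nearPairs, mem_ofPred_eq, two_mul]
  exact h.trans_lt (ENNReal.add_lt_add hy hz)

lemma two_rpow_ne_zero (x : ℝ) : (2 : ℝ≥0∞) ^ x ≠ 0 := by simp
lemma two_rpow_ne_top (x : ℝ) : (2 : ℝ≥0∞) ^ x ≠ ⊤ := by simp

lemma tsum_two_rpow_neg_ne_top {u : ℝ} (hu : 0 < u) :
    (∑' m : ℕ, (2 : ℝ≥0∞) ^ (-(u * m))) ≠ ⊤ := by
  have h (m : ℕ) : (2 : ℝ≥0∞) ^ (-(u * m)) = ((2 : ℝ≥0∞) ^ (-u)) ^ m := by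
    rw [← ENNReal.rpow_natCast, ← ENNReal.rpow_mul]; congr 1; ring
  simp_rw [h, ENNReal.tsum_geometric]
  have : (2 : ℝ≥0∞) ^ (-u) < 1 := by
    rw [ENNReal.rpow_neg]
    exact ENNReal.inv_lt_one.2 (ENNReal.one_lt_rpow (by norm_num) hu)
  simpa [tsub_eq_zero_iff_le] using this

section
variable {X : Type*} [PseudoEMetricSpace X] [MeasurableSpace X] [BorelSpace X]
  [SecondCountableTopology X]

lemma measurableSet_nearPairs (m : ℕ) : MeasurableSet (nearPairs X m) :=
  (isOpen_nearPairs X m).measurableSet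

/-- Disjoint sets of small diameter have disjoint squares near the diagonal, so that the sum of
the squares of their masses, weighted by a power of the diameter, is at most the energy. -/
lemma tsum_mul_sq_le_energy (μ : Measure X) [SFinite μ] (t : ℝ) (V : ℕ → Set X)
    (hV : ∀ i, MeasurableSet (V i)) (hd : Pairwise (Function.onFun Disjoint V)) (m : ℕ → ℕ)
    (hVm : ∀ i, V i ×ˢ V i ⊆ nearPairs X (m i)) :
    ∑' i, (2 : ℝ≥0∞) ^ (t * m i) * (μ (V i) * μ (V i)) ≤
      ∑' j : ℕ, (2 : ℝ≥0∞) ^ (t * j) * (μ.prod μ) (nearPairs X j) := by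
  set Kf : X × X → ℝ≥0∞ := fun p ↦
    ∑' j : ℕ, (nearPairs X j).indicator (fun _ ↦ (2 : ℝ≥0∞) ^ (t * j)) p with hK
  have hKint : ∫⁻ p, Kf p ∂(μ.prod μ) =
      ∑' j : ℕ, (2 : ℝ≥0∞) ^ (t * j) * (μ.prod μ) (nearPairs X j) := by
    rw [hK, lintegral_tsum
      (fun j ↦ (measurable_const.indicator (measurableSet_nearPairs j)).aemeasurable)]
    congr 1; ext j
    rw [lintegral_indicator (measurableSet_nearPairs j), setLIntegral_const]
  rw [← hKint]
  have hdis : Pairwise (Function.onFun Disjoint fun i ↦ V i ×ˢ V i) := fun i j hij ↦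
    Set.disjoint_prod.2 (Or.inl (hd hij))
  calc ∑' i, (2 : ℝ≥0∞) ^ (t * m i) * (μ (V i) * μ (V i))
      ≤ ∑' i, ∫⁻ p in V i ×ˢ V i, Kf p ∂(μ.prod μ) := by
        refine ENNReal.tsum_le_tsum fun i ↦ ?_
        rw [← Measure.prod_prod, ← setLIntegral_const]
        refine setLIntegral_mono' ((hV i).prod (hV i)) fun p hp ↦ ?_
        refine le_trans ?_ (ENNReal.le_tsum (m i))
        rw [Set.indicator_of_mem (hVm i hp)]
    _ = ∫⁻ p in ⋃ i, V i ×ˢ V i, Kf p ∂(μ.prod μ) :=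
        (lintegral_iUnion (fun i ↦ (hV i).prod (hV i)) hdis _).symm
    _ ≤ _ := setLIntegral_le_lintegral _ _

/-- A substitute for the Cauchy–Schwarz inequality: with `a` chosen afterwards, summing it over a
cover compares the total mass with the sums of `c⁻¹` and of `c * x ^ 2`. -/
lemma le_mul_add_inv_mul_sq (a c x : ℝ≥0∞) (ha : a ≠ 0) (ha' : a ≠ ⊤) (hc : c ≠ 0) (hc' : c ≠ ⊤) :
    x ≤ a * c⁻¹ + a⁻¹ * (c * (x * x)) := by
  rcases le_total x (a * c⁻¹) with h | h
  · exact h.trans le_self_add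
  · refine le_trans ?_ le_add_self
    calc
      x = a⁻¹ * (c * ((a * c⁻¹) * x)) := by
          have : a⁻¹ * (c * ((a * c⁻¹) * x)) = (a⁻¹ * a) * (c * c⁻¹) * x := by ring
          rw [this, ENNReal.inv_mul_cancel ha ha', ENNReal.mul_inv_cancel hc hc']; simp
      _ ≤ _ := by gcongr

/-- The mass of a union of balls is controlled by the sum of the powers of their radii and
the energy of the measure. -/
lemma measure_iUnion_eball_le (μ : Measure X) [SFinite μ] (t : ℝ) (x : ℕ → X) (m : ℕ → ℕ)
    (a : ℝ≥0∞) (ha : a ≠ 0) (ha' : a ≠ ⊤) :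
    μ (⋃ i, Metric.eball (x i) ((2 : ℝ≥0∞) ^ (-(m i : ℝ)))) ≤
      a * (∑' i, (2 : ℝ≥0∞) ^ (-(t * m i))) +
        a⁻¹ * ∑' j : ℕ, (2 : ℝ≥0∞) ^ (t * j) * (μ.prod μ) (nearPairs X j) := by
  set U : ℕ → Set X := fun i ↦ Metric.eball (x i) ((2 : ℝ≥0∞) ^ (-(m i : ℝ)))
  have hV : ∀ i, MeasurableSet (disjointed U i) :=
    fun i ↦ MeasurableSet.disjointed (fun i ↦ Metric.isOpen_eball.measurableSet) i
  have hE := tsum_mul_sq_le_energy μ t (disjointed U) hV (disjoint_disjointed U) m fun i ↦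
    (Set.prod_mono (disjointed_subset U i) (disjointed_subset U i)).trans
      (eball_prod_subset_nearPairs (x i) (m i))
  calc μ (⋃ i, U i) = ∑' i, μ (disjointed U i) := by
        rw [← iUnion_disjointed, measure_iUnion (disjoint_disjointed U) hV]
    _ ≤ ∑' i, (a * (2 : ℝ≥0∞) ^ (-(t * m i)) +
          a⁻¹ * ((2 : ℝ≥0∞) ^ (t * m i) * (μ (disjointed U i) * μ (disjointed U i)))) := by
        refine ENNReal.tsum_le_tsum fun i ↦ ?_
        rw [ENNReal.rpow_neg]
        exact le_mul_add_inv_mul_sq _ _ _ ha ha' (two_rpow_ne_zero _) (two_rpow_ne_top _)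
    _ ≤ _ := by
        rw [ENNReal.tsum_add, ENNReal.tsum_mul_left, ENNReal.tsum_mul_left]
        gcongr

end

/-- A set of diameter `d` lies in balls of dyadic radius comparable to `d`; the summand `ε` takes
care of `d = 0`. -/
lemma exists_dyadic_scale {t : ℝ} (ht : 0 < t) {d : ℝ≥0∞} (hd : d ≤ 2⁻¹) {ε : ℝ≥0∞} (hε : 0 < ε) :
    ∃ m : ℕ, d < (2 : ℝ≥0∞) ^ (-(m : ℝ)) ∧
      (2 : ℝ≥0∞) ^ (-(t * m)) ≤ (4 : ℝ≥0∞) ^ t * d ^ t + ε := by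
  have hpow (m : ℕ) : (2 : ℝ≥0∞) ^ (-(m : ℝ)) = (2⁻¹ : ℝ≥0∞) ^ m := by
    rw [ENNReal.rpow_neg, ENNReal.rpow_natCast, ENNReal.inv_pow]
  rcases eq_or_ne d 0 with rfl | hd0
  · have h := ENNReal.tendsto_atTop_zero_of_tsum_ne_top (tsum_two_rpow_neg_ne_top ht)
    obtain ⟨m, hm⟩ := (h.eventually (gt_mem_nhds hε)).exists
    exact ⟨m, pos_iff_ne_zero.2 (two_rpow_ne_zero _), hm.le.trans le_add_self⟩
  · have hdt : d ≠ ⊤ := ne_top_of_le_ne_top (by simp) hd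
    have hr : 0 < d.toReal := ENNReal.toReal_pos hd0 hdt
    have hr2 : d.toReal ≤ 2⁻¹ := by
      have := ENNReal.toReal_mono (by simp) hd
      simpa using this
    obtain ⟨m, h1, h2⟩ := exists_nat_pow_near_of_lt_one (x := 2 * d.toReal) (y := 2⁻¹)
      (by positivity) (by linarith) (by norm_num) (by norm_num)
    have e (m : ℕ) : (2⁻¹ : ℝ≥0∞) ^ m = ENNReal.ofReal ((2⁻¹ : ℝ) ^ m) := by
      rw [ENNReal.ofReal_pow (by norm_num), ENNReal.ofReal_inv_of_pos (by norm_num)]; simp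
    have ed : d = ENNReal.ofReal d.toReal := (ENNReal.ofReal_toReal hdt).symm
    have hle : (2 : ℝ≥0∞) ^ (-(m : ℝ)) ≤ 4 * d := by
      rw [hpow, e, ed, show (4 : ℝ≥0∞) = ENNReal.ofReal 4 by simp,
        ← ENNReal.ofReal_mul (by norm_num)]
      refine ENNReal.ofReal_le_ofReal ?_
      rw [pow_succ] at h1
      linarith
    refine ⟨m, ?_, ?_⟩
    · rw [hpow, e, ed]
      refine (ENNReal.ofReal_lt_ofReal_iff (by positivity)).2 ?_
      linarith
    · refine le_trans ?_ le_self_add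
      rw [← ENNReal.mul_rpow_of_nonneg _ _ ht.le, show -(t * m) = (-(m : ℝ)) * t by ring,
        ENNReal.rpow_mul]
      gcongr

/-- Lower bound for the Hausdorff dimension by correlation: if the members of a decreasing sequence
of compact sets carry measures of mass bounded from below, for which the probability that two points
are at distance `≲ r` is `≲ r ^ s` uniformly, then the intersection has dimension at least `s`.
No limit measure is needed: a cover of the intersection covers one of the compact sets. -/
theorem hausdorffMeasure_iInter_ne_zero_of_correlation {X : Type*} [EMetricSpace X]
    [MeasurableSpace X] [BorelSpace X] [SecondCountableTopology X] (K : ℕ → Set X)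
    (hK : Antitone K) (hKc : ∀ j, IsCompact (K j)) (μ : ℕ → Measure X) [∀ j, SFinite (μ j)]
    (hμK : ∀ j, μ j (K j)ᶜ = 0) (β A : ℝ≥0∞) (hβ : β ≠ 0) (hβ' : β ≠ ⊤) (hA : A ≠ ⊤)
    (hμβ : ∀ j, β ≤ μ j univ) (s t : ℝ) (ht : 0 < t) (hts : t < s)
    (hcor : ∀ j m : ℕ, ((μ j).prod (μ j)) (nearPairs X m) ≤ A * (2 : ℝ≥0∞) ^ (-(s * m))) :
    Measure.hausdorffMeasure t (⋂ j, K j) ≠ 0 := by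
  intro h0
  -- the energies of the measures are uniformly bounded
  set I : ℝ≥0∞ := 1 + A * ∑' m : ℕ, (2 : ℝ≥0∞) ^ (-((s - t) * m)) with hI
  have hItop : I ≠ ⊤ := ENNReal.add_ne_top.2 ⟨by simp,
    ENNReal.mul_ne_top hA (tsum_two_rpow_neg_ne_top (sub_pos.2 hts))⟩
  have hIpos : I ≠ 0 := by simp [hI]
  have hEn (j : ℕ) :
      ∑' m : ℕ, (2 : ℝ≥0∞) ^ (t * m) * ((μ j).prod (μ j)) (nearPairs X m) ≤ I := by
    refine le_trans ?_ le_add_self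
    rw [← ENNReal.tsum_mul_left]
    refine ENNReal.tsum_le_tsum fun m ↦ ?_
    calc (2 : ℝ≥0∞) ^ (t * m) * ((μ j).prod (μ j)) (nearPairs X m)
        ≤ (2 : ℝ≥0∞) ^ (t * m) * (A * (2 : ℝ≥0∞) ^ (-(s * m))) := by gcongr; exact hcor j m
      _ = A * ((2 : ℝ≥0∞) ^ (t * m) * (2 : ℝ≥0∞) ^ (-(s * m))) := by ring
      _ = _ := by
        rw [← ENNReal.rpow_add _ _ (by norm_num) (by norm_num)]; congr 2; ring
  -- the weight `a` makes the energy term in `measure_iUnion_eball_le` at most a quarter of `β`,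
  -- and covers with sum at most `η` make the other term as small
  set a : ℝ≥0∞ := I * (β / 2 / 2)⁻¹ with hadef
  have hβ4 : β / 2 / 2 ≠ 0 :=
    (ENNReal.div_pos (ENNReal.div_pos hβ (by norm_num)).ne' (by norm_num)).ne'
  have hβ4' : β / 2 / 2 ≠ ⊤ :=
    ENNReal.div_ne_top (ENNReal.div_ne_top hβ' (by norm_num)) (by norm_num)
  have ha : a ≠ 0 := mul_ne_zero hIpos (ENNReal.inv_ne_zero.2 hβ4')
  have ha' : a ≠ ⊤ := ENNReal.mul_ne_top hItop (ENNReal.inv_ne_top.2 hβ4)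
  have haI : a⁻¹ * I = β / 2 / 2 := by
    rw [hadef, ENNReal.mul_inv (Or.inl hIpos) (Or.inl hItop), inv_inv, mul_right_comm,
      ENNReal.inv_mul_cancel hIpos hItop, one_mul]
  set η : ℝ≥0∞ := a⁻¹ * (β / 2 / 2) with hη
  have hη0 : η ≠ 0 := mul_ne_zero (ENNReal.inv_ne_zero.2 ha') hβ4
  have haη : a * η = β / 2 / 2 := by
    rw [hη, ← mul_assoc, ENNReal.mul_inv_cancel ha ha', one_mul]
  -- an efficient cover of the intersection
  have hη2 : η / 2 ≠ 0 := (ENNReal.div_pos hη0 (by norm_num)).ne'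
  set ζ : ℝ≥0∞ := ((4 : ℝ≥0∞) ^ t)⁻¹ * (η / 2) with hζ
  have h4 : (4 : ℝ≥0∞) ^ t ≠ 0 := by simp
  have h4' : (4 : ℝ≥0∞) ^ t ≠ ⊤ := by simp
  have hζ0 : 0 < ζ := pos_iff_ne_zero.2 (mul_ne_zero (ENNReal.inv_ne_zero.2 h4') hη2)
  have hcov : ∃ T : ℕ → Set X, (⋂ j, K j) ⊆ ⋃ n, T n ∧ (∀ n, Metric.ediam (T n) ≤ 2⁻¹) ∧
      ∑' n, ⨆ _ : (T n).Nonempty, Metric.ediam (T n) ^ t < ζ := by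
    rw [Measure.hausdorffMeasure_apply] at h0
    have h1 : ⨅ (T : ℕ → Set X) (_ : (⋂ j, K j) ⊆ ⋃ n, T n) (_ : ∀ n, Metric.ediam (T n) ≤ 2⁻¹),
        ∑' n, ⨆ _ : (T n).Nonempty, Metric.ediam (T n) ^ t = 0 := by
      have := ENNReal.iSup_eq_zero.1 h0 2⁻¹
      exact ENNReal.iSup_eq_zero.1 this (by simp)
    have h2 := h1.trans_lt hζ0
    simp only [iInf_lt_iff] at h2
    obtain ⟨T, a1, a2, a3⟩ := h2
    exact ⟨T, a1, a2, a3⟩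
  obtain ⟨T, hT, hTd, hTs⟩ := hcov
  obtain ⟨ε, hε0, hεs⟩ := ENNReal.exists_pos_sum_of_countable' hη2 ℕ
  have hne : Nonempty X := by
    by_contra hX
    rw [not_nonempty_iff] at hX
    have := hμβ 0
    rw [Set.eq_empty_of_isEmpty (univ : Set X)] at this
    simp at this
    exact hβ this
  have hball (n : ℕ) : ∃ (x : X) (m : ℕ), T n ⊆ Metric.eball x ((2 : ℝ≥0∞) ^ (-(m : ℝ))) ∧
      (2 : ℝ≥0∞) ^ (-(t * m)) ≤
        (4 : ℝ≥0∞) ^ t * (⨆ _ : (T n).Nonempty, Metric.ediam (T n) ^ t) + ε n := by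
    rcases (T n).eq_empty_or_nonempty with h | h
    · obtain ⟨m, -, hm⟩ := exists_dyadic_scale ht (d := 0) (by simp) (hε0 n)
      refine ⟨hne.some, m, by simp [h], ?_⟩
      simpa [h, ht] using hm
    · obtain ⟨m, hm1, hm2⟩ := exists_dyadic_scale ht (hTd n) (hε0 n)
      obtain ⟨x, hx⟩ := h
      refine ⟨x, m, fun y hy ↦ ?_, ?_⟩
      · exact (Metric.edist_le_ediam_of_mem hy hx).trans_lt hm1
      · rwa [iSup_pos ⟨x, hx⟩]
  choose x m hxm hm using hball
  have hU : ∀ y ∈ ⋂ j, K j, (⋃ n, Metric.eball (x n) ((2 : ℝ≥0∞) ^ (-(m n : ℝ)))) ∈ 𝓝 y := by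
    intro y hy
    refine (isOpen_iUnion fun n ↦ Metric.isOpen_eball).mem_nhds ?_
    exact Set.iUnion_mono hxm (hT hy)
  obtain ⟨j, hj⟩ := exists_subset_nhds_of_isCompact hK.directed_ge hKc hU
  have hsum : ∑' n, (2 : ℝ≥0∞) ^ (-(t * m n)) ≤ η := by
    calc _ ≤ ∑' n, ((4 : ℝ≥0∞) ^ t * (⨆ _ : (T n).Nonempty, Metric.ediam (T n) ^ t) + ε n) :=
          ENNReal.tsum_le_tsum hm
      _ ≤ (4 : ℝ≥0∞) ^ t * ζ + η / 2 := by
          rw [ENNReal.tsum_add, ENNReal.tsum_mul_left]; gcongr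
      _ = η := by
          rw [hζ, ← mul_assoc, ENNReal.mul_inv_cancel h4 h4', one_mul, ENNReal.add_halves]
  have hfin : β ≤ β / 2 / 2 + β / 2 / 2 := by
    calc β ≤ μ j univ := hμβ j
      _ ≤ μ j (K j) + μ j (K j)ᶜ := by rw [← Set.union_compl_self (K j)]; exact measure_union_le _ _
      _ ≤ μ j (⋃ n, Metric.eball (x n) ((2 : ℝ≥0∞) ^ (-(m n : ℝ)))) := by
          rw [hμK, add_zero]; exact measure_mono hj
      _ ≤ _ := measure_iUnion_eball_le (μ j) t x m a ha ha'
      _ ≤ a * η + a⁻¹ * I := by gcongr; exact hEn j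
      _ = _ := by rw [haη, haI]
  rw [ENNReal.add_halves] at hfin
  exact absurd hfin (not_le.2 (ENNReal.half_lt_self hβ hβ'))

/-! ### Multiplying densities along a sequence of sets -/

lemma hasCompactSupport_prod_mul {X : Type*} [TopologicalSpace X] [R1Space X] {f : X → ℝ}
    {S : Set X} (hS : IsCompact S) (hf : ∀ x ∉ S, f x = 0) (F : X × X → ℝ) :
    HasCompactSupport fun p : X × X ↦ F p * (f p.1 * f p.2) := by
  refine HasCompactSupport.intro (hS.prod hS) fun p hp ↦ ?_
  rw [Set.mem_prod, not_and_or] at hp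
  rcases hp with h | h <;> simp [hf _ h]

section
variable {X : Type*} [MetricSpace X] [MeasurableSpace X] [BorelSpace X]
  [SecondCountableTopology X]

/-- A continuous density on a compact set with small correlation integrals gives a measure with
small correlations. -/
lemma withDensity_prod_nearPairs_le (ν : Measure X) [SFinite ν] [IsFiniteMeasureOnCompacts ν]
    {f : X → ℝ} (hfc : Continuous f) (hf0 : ∀ x, 0 ≤ f x) {S : Set X} (hS : IsCompact S)
    (hfS : ∀ x ∉ S, f x = 0) {φ : X × X → ℝ} (hφc : Continuous φ) (hφ0 : ∀ p, 0 ≤ φ p)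
    {κ : ℝ} (hκ : 0 < κ) {m : ℕ} (hφ : ∀ p ∈ nearPairs X m, κ ≤ φ p) :
    ((ν.withDensity fun x ↦ ENNReal.ofReal (f x)).prod
      (ν.withDensity fun x ↦ ENNReal.ofReal (f x))) (nearPairs X m) ≤
      ENNReal.ofReal (κ⁻¹ * ∫ p, φ p * (f p.1 * f p.2) ∂ν.prod ν) := by
  have hm : Measurable fun x ↦ ENNReal.ofReal (f x) := by fun_prop
  rw [prod_withDensity hm hm, withDensity_apply _ (measurableSet_nearPairs m)]
  have hint : Integrable (fun p : X × X ↦ φ p * (f p.1 * f p.2)) (ν.prod ν) :=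
    Continuous.integrable_of_hasCompactSupport (by fun_prop) (hasCompactSupport_prod_mul hS hfS φ)
  rw [← integral_const_mul, ofReal_integral_eq_lintegral_ofReal (hint.const_mul _)]
  · refine le_trans (setLIntegral_mono' (measurableSet_nearPairs m) fun p hp ↦ ?_)
      (setLIntegral_le_lintegral (nearPairs X m) _)
    rw [← ENNReal.ofReal_mul (hf0 _)]
    refine ENNReal.ofReal_le_ofReal ?_
    have h1 : 1 ≤ κ⁻¹ * φ p := by
      rw [inv_mul_eq_div, one_le_div hκ]; exact hφ p hp
    rw [← mul_assoc]
    exact le_mul_of_one_le_left (mul_nonneg (hf0 _) (hf0 _)) h1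
  · exact Eventually.of_forall fun p ↦
      mul_nonneg (inv_pos.2 hκ).le (mul_nonneg (hφ0 p) (mul_nonneg (hf0 _) (hf0 _)))

/-- A continuous density supported on the compact set `S ⊆ K`, the square of whose mass, written
as a double integral, is greater than `b`, and whose correlation
integral at every scale `2 ^ (-m)` is less than `A * 2 ^ (-(s * m))`. -/
structure IsCorrelationDensity (ν : Measure X) (φ : ℕ → X × X → ℝ) (K : Set X) (b A s : ℝ)
    (f : X → ℝ) (S : Set X) : Prop where
  continuous : Continuous f
  nonneg : ∀ x, 0 ≤ f x
  isCompact : IsCompact S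
  subset : S ⊆ K
  eq_zero : ∀ x ∉ S, f x = 0
  lt_mass : b < ∫ p, f p.1 * f p.2 ∂ν.prod ν
  correlation_lt : ∀ m : ℕ, ∫ p, φ m p * (f p.1 * f p.2) ∂ν.prod ν < A * 2 ^ (-(s * m))

/-- Multiplication by a far member of a sequence of densities that equidistribute and have
uniformly good small-scale correlations preserves the correlation bounds: large scales are
handled by equidistribution, small ones by the boundedness of the old density. -/
lemma IsCorrelationDensity.exists_mul (ν : Measure X) [SFinite ν] [IsFiniteMeasureOnCompacts ν]
    {φ : ℕ → X × X → ℝ} (hφc : ∀ m, Continuous (φ m)) (hφ0 : ∀ m p, 0 ≤ φ m p)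
    {K : Set X} (hK : IsCompact K) {b A s s' C : ℝ} (hA : 0 < A) (hs : s < s')
    {f : X → ℝ} {S : Set X} (h : IsCorrelationDensity ν φ K b A s f S)
    {E : ℕ → Set X} (hE : ∀ l, IsClosed (E l)) {g : ℕ → X → ℝ} (hgc : ∀ l, Continuous (g l))
    (hg0 : ∀ l x, 0 ≤ g l x) (hgE : ∀ l, ∀ x ∉ E l, g l x = 0)
    (hweak : ∀ F : X × X → ℝ, Continuous F → HasCompactSupport F →
      Tendsto (fun l ↦ ∫ p, F p * (g l p.1 * g l p.2) ∂ν.prod ν) atTop (𝓝 (∫ p, F p ∂ν.prod ν)))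
    (hcor : ∀ l m, ∫ p in K ×ˢ K, φ m p * (g l p.1 * g l p.2) ∂ν.prod ν ≤
      C * 2 ^ (-(s' * (m : ℝ)))) (N : ℕ) :
    ∃ l, N ≤ l ∧ IsCorrelationDensity ν φ K b A s (fun x ↦ f x * g l x) (S ∩ E l) := by
  obtain ⟨B, hB⟩ := (Continuous.bounded_above_of_compact_support h.continuous
    (HasCompactSupport.intro h.isCompact h.eq_zero))
  have hB' (x : X) : f x ≤ B := (le_abs_self _).trans (hB x)
  -- small scales
  have hdecay : Tendsto (fun m : ℕ ↦ B * B * C * (2 : ℝ) ^ (-((s' - s) * (m : ℝ)))) atTop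
      (𝓝 0) := by
    have h1 : Tendsto (fun m : ℕ ↦ ((2 : ℝ) ^ (-(s' - s))) ^ m) atTop (𝓝 0) :=
      tendsto_pow_atTop_nhds_zero_of_lt_one (by positivity)
        (Real.rpow_lt_one_of_one_lt_of_neg (by norm_num) (by linarith))
    have h2 := h1.const_mul (B * B * C)
    rw [mul_zero] at h2
    refine h2.congr fun m ↦ ?_
    rw [← Real.rpow_natCast, ← Real.rpow_mul (by norm_num)]
    congr 2; ring
  obtain ⟨M, hM⟩ := eventually_atTop.1 (hdecay.eventually (gt_mem_nhds hA))
  have hsmall (l m : ℕ) (hm : M ≤ m) :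
      ∫ p, φ m p * ((f p.1 * g l p.1) * (f p.2 * g l p.2)) ∂ν.prod ν < A * 2 ^ (-(s * m)) := by
    have hle : ∫ p, φ m p * ((f p.1 * g l p.1) * (f p.2 * g l p.2)) ∂ν.prod ν ≤
        ∫ p in K ×ˢ K, B * B * (φ m p * (g l p.1 * g l p.2)) ∂ν.prod ν := by
      rw [← setIntegral_eq_integral_of_forall_compl_eq_zero (s := K ×ˢ K)]
      · have hcK : IsCompact (K ×ˢ K) := hK.prod hK
        refine setIntegral_mono_on ?_ ?_ hcK.measurableSet fun p _ ↦ ?_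
        · refine ContinuousOn.integrableOn_compact hcK (Continuous.continuousOn ?_)
          have := h.continuous; have := hgc l; have := hφc m
          fun_prop
        · refine ContinuousOn.integrableOn_compact hcK (Continuous.continuousOn ?_)
          have := hgc l; have := hφc m
          fun_prop
        · have e : φ m p * ((f p.1 * g l p.1) * (f p.2 * g l p.2)) =
              (f p.1 * f p.2) * (φ m p * (g l p.1 * g l p.2)) := by ring
          rw [e]
          refine mul_le_mul_of_nonneg_right ?_
            (mul_nonneg (hφ0 _ _) (mul_nonneg (hg0 _ _) (hg0 _ _)))
          exact mul_le_mul (hB' _) (hB' _) (h.nonneg _) ((h.nonneg p.1).trans (hB' _))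
      · intro p hp
        rw [Set.mem_prod, not_and_or] at hp
        rcases hp with hp | hp <;> simp [h.eq_zero _ fun hx ↦ hp (h.subset hx)]
    refine hle.trans_lt ?_
    rw [integral_const_mul]
    calc B * B * ∫ p in K ×ˢ K, φ m p * (g l p.1 * g l p.2) ∂ν.prod ν
        ≤ B * B * (C * 2 ^ (-(s' * (m : ℝ)))) := by
          gcongr
          · exact mul_self_nonneg B
          · exact hcor l m
      _ = (B * B * C * 2 ^ (-((s' - s) * (m : ℝ)))) * 2 ^ (-(s * m)) := by
          rw [mul_assoc _ _ ((2 : ℝ) ^ (-(s * m))), ← Real.rpow_add (by norm_num)]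
          rw [show -((s' - s) * (m : ℝ)) + -(s * m) = -(s' * m) by ring]
          ring
      _ < _ := by
          have := hM m hm
          gcongr
  -- large scales
  have hlarge (m : ℕ) : ∀ᶠ l in atTop,
      ∫ p, φ m p * ((f p.1 * g l p.1) * (f p.2 * g l p.2)) ∂ν.prod ν < A * 2 ^ (-(s * m)) := by
    have h1 := hweak (fun p ↦ φ m p * (f p.1 * f p.2))
      (by have := h.continuous; have := hφc m; fun_prop)
      (hasCompactSupport_prod_mul h.isCompact h.eq_zero _)
    filter_upwards [h1.eventually (gt_mem_nhds (h.correlation_lt m))] with l hl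
    exact lt_of_eq_of_lt (integral_congr_ae (.of_forall fun p ↦ by dsimp only; ring)) hl
  have hmass : ∀ᶠ l in atTop,
      b < ∫ p, (f p.1 * g l p.1) * (f p.2 * g l p.2) ∂ν.prod ν := by
    have h1 := hweak (fun p ↦ f p.1 * f p.2) (by have := h.continuous; fun_prop)
      (by simpa using hasCompactSupport_prod_mul h.isCompact h.eq_zero fun _ ↦ 1)
    filter_upwards [h1.eventually (lt_mem_nhds h.lt_mass)] with l hl
    exact hl.trans_eq (integral_congr_ae (.of_forall fun p ↦ by dsimp only; ring))
  have hall : ∀ᶠ l in atTop, ∀ m ∈ Finset.range M,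
      ∫ p, φ m p * ((f p.1 * g l p.1) * (f p.2 * g l p.2)) ∂ν.prod ν < A * 2 ^ (-(s * m)) :=
    (Finset.eventually_all _).2 fun m _ ↦ hlarge m
  obtain ⟨l, ⟨h1, h2⟩, h3⟩ := ((hall.and hmass).and (eventually_ge_atTop N)).exists
  refine ⟨l, h3, ⟨h.continuous.mul (hgc l), fun x ↦ mul_nonneg (h.nonneg x) (hg0 l x),
    h.isCompact.inter_right (hE l), Set.inter_subset_left.trans h.subset, fun x hx ↦ ?_, h2,
    fun m ↦ ?_⟩⟩
  · rw [Set.mem_inter_iff, not_and_or] at hx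
    rcases hx with hx | hx
    · rw [h.eq_zero x hx, zero_mul]
    · rw [hgE l x hx, mul_zero]
  · by_cases hm : m < M
    · exact h1 m (Finset.mem_range.2 hm)
    · exact hsmall l m (not_lt.1 hm)

/-- If the closed sets `E l` carry densities `g l` that equidistribute (in pairs) and whose
correlations at scale `2 ^ (-m)` are uniformly `O(2 ^ (-(s' * m)))`, then the upper limit of the
sets `E l` has, inside a compact set carrying a density with the same property, dimension at least
every `s < s'`. -/
theorem le_dimH_limsup_of_correlation (ν : Measure X) [SFinite ν] [IsFiniteMeasureOnCompacts ν]
    {φ : ℕ → X × X → ℝ} (hφc : ∀ m, Continuous (φ m)) (hφ0 : ∀ m p, 0 ≤ φ m p)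
    {κ : ℝ} (hκ : 0 < κ) (hφ : ∀ m, ∀ p ∈ nearPairs X m, κ ≤ φ m p)
    {K : Set X} (hK : IsCompact K) {A s s' C : ℝ} (hA : 0 < A) (hs : s < s')
    {f : X → ℝ} (hf : IsCorrelationDensity ν φ K 0 A s f K)
    {E : ℕ → Set X} (hE : ∀ l, IsClosed (E l)) {g : ℕ → X → ℝ} (hgc : ∀ l, Continuous (g l))
    (hg0 : ∀ l x, 0 ≤ g l x) (hgE : ∀ l, ∀ x ∉ E l, g l x = 0)
    (hweak : ∀ F : X × X → ℝ, Continuous F → HasCompactSupport F →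
      Tendsto (fun l ↦ ∫ p, F p * (g l p.1 * g l p.2) ∂ν.prod ν) atTop (𝓝 (∫ p, F p ∂ν.prod ν)))
    (hcor : ∀ l m, ∫ p in K ×ˢ K, φ m p * (g l p.1 * g l p.2) ∂ν.prod ν ≤
      C * 2 ^ (-(s' * (m : ℝ)))) :
    ENNReal.ofReal s ≤ dimH (K ∩ ⋂ N : ℕ, ⋃ l ≥ N, E l) := by
  obtain ⟨b, hb0, hb⟩ := exists_between hf.lt_mass
  -- the sequence of densities
  let St := {q : (X → ℝ) × Set X × ℕ // IsCorrelationDensity ν φ K b A s q.1 q.2.1}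
  have hstep (q : St) : ∃ q' : St, q'.1.2.1 = q.1.2.1 ∩ E q'.1.2.2 ∧ q.1.2.2 + 1 ≤ q'.1.2.2 := by
    obtain ⟨l, hl, hd⟩ := q.2.exists_mul ν hφc hφ0 hK hA hs hE hgc hg0 hgE hweak hcor
      (q.1.2.2 + 1)
    exact ⟨⟨⟨_, _, l⟩, hd⟩, rfl, hl⟩
  choose next hn1 hn2 using hstep
  let q0 : St := ⟨⟨f, K, 0⟩, { hf with lt_mass := hb }⟩
  let q : ℕ → St := fun j ↦ next^[j] q0
  have hqs (j : ℕ) : q (j + 1) = next (q j) := Function.iterate_succ_apply' _ _ _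
  have hS (j : ℕ) : (q (j + 1)).1.2.1 = (q j).1.2.1 ∩ E (q (j + 1)).1.2.2 := by
    rw [hqs]; exact hn1 (q j)
  have hl (j : ℕ) : j ≤ (q j).1.2.2 := by
    induction j with
    | zero => exact Nat.zero_le _
    | succ j ih => rw [hqs]; exact (Nat.succ_le_succ ih).trans (hn2 (q j))
  have hanti : Antitone fun j ↦ (q j).1.2.1 :=
    antitone_nat_of_succ_le fun j ↦ by rw [hS]; exact Set.inter_subset_left
  have hsub : (⋂ j, (q j).1.2.1) ⊆ K ∩ ⋂ N : ℕ, ⋃ l ≥ N, E l := by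
    intro x hx
    rw [Set.mem_iInter] at hx
    refine ⟨hx 0, Set.mem_iInter.2 fun N ↦ ?_⟩
    have := hx (N + 1)
    rw [hS] at this
    exact Set.mem_iUnion₂.2 ⟨_, (Nat.le_succ N).trans (hl (N + 1)), this.2⟩
  refine le_trans ?_ (dimH_mono hsub)
  -- the associated measures
  let μ : ℕ → Measure X := fun j ↦ ν.withDensity fun x ↦ ENNReal.ofReal ((q j).1.1 x)
  have hint (j : ℕ) : Integrable (q j).1.1 ν :=
    (q j).2.continuous.integrable_of_hasCompactSupport
      (HasCompactSupport.intro (q j).2.isCompact (q j).2.eq_zero)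
  have hμK (j : ℕ) : μ j ((q j).1.2.1)ᶜ = 0 := by
    have hm := (q j).2.isCompact.measurableSet.compl
    rw [withDensity_apply _ hm, setLIntegral_congr_fun hm (g := fun _ ↦ 0), lintegral_zero]
    intro x hx
    simp [(q j).2.eq_zero x hx]
  have hμb (j : ℕ) : ENNReal.ofReal (√b) ≤ μ j univ := by
    rw [withDensity_apply _ MeasurableSet.univ, Measure.restrict_univ,
      ← ofReal_integral_eq_lintegral_ofReal (hint j) (Eventually.of_forall (q j).2.nonneg)]
    refine ENNReal.ofReal_le_ofReal ?_
    have h1 := (q j).2.lt_mass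
    rw [integral_prod_mul] at h1
    refine Real.sqrt_le_iff.2 ⟨integral_nonneg (q j).2.nonneg, ?_⟩
    rw [sq]; exact h1.le
  have hμc (j m : ℕ) : ((μ j).prod (μ j)) (nearPairs X m) ≤
      ENNReal.ofReal (κ⁻¹ * A) * (2 : ℝ≥0∞) ^ (-(s * m)) := by
    refine (withDensity_prod_nearPairs_le ν (q j).2.continuous (q j).2.nonneg (q j).2.isCompact
      (q j).2.eq_zero (hφc m) (hφ0 m) hκ (hφ m)).trans ?_
    have e : (2 : ℝ≥0∞) ^ (-(s * m)) = ENNReal.ofReal ((2 : ℝ) ^ (-(s * m))) := by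
      rw [← ENNReal.ofReal_rpow_of_pos (by norm_num)]; simp
    rw [e, ← ENNReal.ofReal_mul (by positivity), mul_assoc]
    refine ENNReal.ofReal_le_ofReal ?_
    have := ((q j).2.correlation_lt m).le
    gcongr
  refine le_of_forall_lt fun d hd ↦ ?_
  obtain ⟨t, hdt, hts⟩ := ENNReal.lt_iff_exists_nnreal_btwn.1 hd
  have ht0 : 0 < t := ENNReal.coe_pos.1 ((zero_le).trans_lt hdt)
  have hts' : (t : ℝ) < s := by
    have := (ENNReal.lt_ofReal_iff_toReal_lt ENNReal.coe_ne_top).1 hts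
    simpa using this
  refine hdt.trans_le (le_dimH_of_hausdorffMeasure_ne_zero ?_)
  exact hausdorffMeasure_iInter_ne_zero_of_correlation _ hanti (fun j ↦ (q j).2.isCompact) μ hμK
    (ENNReal.ofReal √b) (ENNReal.ofReal (κ⁻¹ * A)) (by simpa using hb0) ENNReal.ofReal_ne_top
    ENNReal.ofReal_ne_top hμb s t (by exact_mod_cast ht0) hts' hμc

end

/-! ### Equidistribution of rapidly oscillating densities -/

/-- A bounded continuous nonnegative function whose average over the translates by some
probability measure carried by the ball of radius `δ` is identically `1`. -/
structure IsAveraging {E : Type*} [NormedAddCommGroup E] [MeasurableSpace E] (δ : ℝ) (H : E → ℝ) :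
    Prop where
  continuous : Continuous H
  nonneg : ∀ x, 0 ≤ H x
  bounded : ∃ B, ∀ x, H x ≤ B
  average : ∃ ρ : Measure E, IsProbabilityMeasure ρ ∧ (∀ᵐ τ ∂ρ, ‖τ‖ ≤ δ) ∧
    ∀ x, ∫ τ, H (x + τ) ∂ρ = 1

lemma IsAveraging.prod {E F : Type*} [NormedAddCommGroup E] [MeasurableSpace E]
    [NormedAddCommGroup F] [MeasurableSpace F] {δ : ℝ} {H : E → ℝ} {G : F → ℝ}
    (hH : IsAveraging δ H) (hG : IsAveraging δ G) :
    IsAveraging δ fun p : E × F ↦ H p.1 * G p.2 := by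
  obtain ⟨B, hB⟩ := hH.bounded
  obtain ⟨B', hB'⟩ := hG.bounded
  obtain ⟨ρ, h1, h2, h3⟩ := hH.average
  obtain ⟨ρ', h1', h2', h3'⟩ := hG.average
  refine ⟨?_, fun p ↦ mul_nonneg (hH.nonneg _) (hG.nonneg _), ⟨B * B', fun p ↦ ?_⟩,
    ρ.prod ρ', inferInstance, ?_, fun p ↦ ?_⟩
  · have := hH.continuous; have := hG.continuous; fun_prop
  · exact mul_le_mul (hB _) (hB' _) (hG.nonneg _) ((hH.nonneg _).trans (hB p.1))
  · filter_upwards [Measure.quasiMeasurePreserving_fst.ae h2,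
      Measure.quasiMeasurePreserving_snd.ae h2'] with τ a b
    exact max_le a b
  · have := integral_prod_mul (μ := ρ) (ν := ρ') (fun τ ↦ H (p.1 + τ)) (fun τ ↦ G (p.2 + τ))
    rw [h3, h3', one_mul] at this
    exact this

lemma IsAveraging.pi {ι : Type*} [Fintype ι] {δ : ℝ} (hδ : 0 ≤ δ) {u : ι → ℝ → ℝ}
    (hu : ∀ i, IsAveraging δ (u i)) : IsAveraging δ fun x : ι → ℝ ↦ ∏ i, u i (x i) := by
  choose B hB using fun i ↦ (hu i).bounded
  choose ρ h1 h2 h3 using fun i ↦ (hu i).average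
  refine ⟨?_, fun x ↦ Finset.prod_nonneg fun i _ ↦ (hu i).nonneg _, ⟨∏ i, B i, fun x ↦
    Finset.prod_le_prod (fun i _ ↦ (hu i).nonneg _) fun i _ ↦ hB i _⟩, Measure.pi ρ,
    inferInstance, ?_, fun x ↦ ?_⟩
  · exact continuous_finsetProd _ fun i _ ↦ (hu i).continuous.comp (continuous_apply i)
  · have : ∀ᵐ τ ∂Measure.pi ρ, ∀ i, ‖τ i‖ ≤ δ :=
      ae_all_iff.2 fun i ↦ (Measure.tendsto_eval_ae_ae (μ := ρ) (i := i)).eventually (h2 i)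
    filter_upwards [this] with τ hτ
    exact (pi_norm_le_iff_of_nonneg hδ).2 hτ
  · have := integral_fintype_prod_eq_prod (μ := ρ) (fun i τ ↦ u i (x i + τ))
    simp only [h3, Finset.prod_const_one] at this
    exact this

/-- A periodic function of mean one, rescaled to a small period, is averaging at the scale of
the period. -/
lemma isAveraging_comp_mul {u : ℝ → ℝ} (hu : Continuous u) (hu0 : ∀ x, 0 ≤ u x)
    (hp : Function.Periodic u 1) (hint : ∫ x in (0 : ℝ)..1, u x = 1) {l : ℝ} (hl : 0 < l) :
    IsAveraging l⁻¹ fun x ↦ u (l * x) := by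
  have hli : 0 < l⁻¹ := inv_pos.2 hl
  refine ⟨by fun_prop, fun x ↦ hu0 _, ?_, ?_⟩
  · obtain ⟨B, hB⟩ := isCompact_Icc.bddAbove_image (K := Icc (0 : ℝ) 1) hu.continuousOn
    refine ⟨B, fun x ↦ ?_⟩
    obtain ⟨y, hy, e⟩ := hp.exists_mem_Ico₀ one_pos (l * x)
    rw [e]
    exact hB ⟨y, Ico_subset_Icc_self hy, rfl⟩
  · refine ⟨(ENNReal.ofReal l) • (volume.restrict (Ioc 0 l⁻¹)), ⟨?_⟩, ?_, fun x ↦ ?_⟩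
    · rw [Measure.smul_apply, Measure.restrict_apply_univ, Real.volume_Ioc, sub_zero, smul_eq_mul,
        ← ENNReal.ofReal_mul hl.le, mul_inv_cancel₀ hl.ne', ENNReal.ofReal_one]
    · refine Measure.ae_smul_measure ?_ _
      filter_upwards [ae_restrict_mem measurableSet_Ioc] with τ hτ
      rw [Real.norm_eq_abs, abs_of_pos hτ.1]; exact hτ.2
    · rw [integral_smul_measure, ENNReal.toReal_ofReal hl.le,
        ← intervalIntegral.integral_of_le hli.le]
      have e : ∀ τ, u (l * (x + τ)) = u (l * x + l * τ) := fun τ ↦ by rw [mul_add]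
      simp_rw [e]
      rw [intervalIntegral.smul_integral_comp_add_mul u l (l * x), mul_zero, add_zero,
        mul_inv_cancel₀ hl.ne', hp.intervalIntegral_add_eq (l * x) 0, zero_add, hint]

/-- An averaging function is close to `1` in the weak sense. Both the integral of `F * H` and that
of `F` are averages over `τ` of integrals against `H (x + τ)`, of `F (x + τ)` and of `F x`. -/
lemma IsAveraging.abs_integral_mul_sub_le {E : Type*} [NormedAddCommGroup E] [MeasurableSpace E]
    [BorelSpace E] [SecondCountableTopology E] (ν : Measure E) [SFinite ν]
    [IsFiniteMeasureOnCompacts ν] [ν.IsAddRightInvariant] {δ : ℝ} {H : E → ℝ}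
    (hH : IsAveraging δ H) {F : E → ℝ} (hF : Continuous F) (hFc : HasCompactSupport F)
    {T : Set E} (hT : IsCompact T) (hFT : ∀ x τ, ‖τ‖ ≤ δ → x ∉ T → F (x + τ) = 0 ∧ F x = 0)
    {ε : ℝ} (hFε : ∀ x τ, ‖τ‖ ≤ δ → |F (x + τ) - F x| ≤ ε) :
    |∫ x, F x * H x ∂ν - ∫ x, F x ∂ν| ≤ ε * ν.real T := by
  obtain ⟨B, hB⟩ := hH.bounded
  obtain ⟨ρ, hρ, hρδ, hav⟩ := hH.average
  have hHc := hH.continuous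
  have hB0 (x : E) : ‖H x‖ ≤ B := by
    rw [Real.norm_eq_abs, abs_of_nonneg (hH.nonneg x)]; exact hB x
  have hFi : Integrable F ν := hF.integrable_of_hasCompactSupport hFc
  have hswap (G : E → ℝ) (hG : Integrable G ν) :
      Integrable (fun p : E × E ↦ G p.1 * H (p.1 + p.2)) (ν.prod ρ) := by
    have h1 : Integrable (fun p : E × E ↦ G p.1) (ν.prod ρ) := hG.comp_fst ρ
    refine h1.mul_bdd (c := B) ?_ (Eventually.of_forall fun p ↦ hB0 _)
    exact (hHc.comp (continuous_fst.add continuous_snd)).aestronglyMeasurable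
  have hmean (G : E → ℝ) (hG : Integrable G ν) :
      ∫ τ, ∫ x, G x * H (x + τ) ∂ν ∂ρ = ∫ x, G x ∂ν := by
    rw [← integral_integral_swap (hswap G hG)]
    simp_rw [integral_const_mul, hav, mul_one]
  have hint (G : E → ℝ) (hG : Integrable G ν) :
      Integrable (fun τ ↦ ∫ x, G x * H (x + τ) ∂ν) ρ := (hswap G hG).integral_prod_right
  have hTi : Integrable (T.indicator fun _ ↦ (1 : ℝ)) ν :=
    (integrable_indicator_iff hT.measurableSet).2 (integrableOn_const hT.measure_lt_top.ne)
  have hslice (G : E → ℝ) (hG : Integrable G ν) (τ : E) :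
      Integrable (fun x ↦ G x * H (x + τ)) ν :=
    hG.mul_bdd (c := B) (hHc.comp (continuous_add_const τ)).aestronglyMeasurable
      (Eventually.of_forall fun x ↦ hB0 _)
  have hptw (τ : E) (hτ : ‖τ‖ ≤ δ) :
      |∫ x, F x * H x ∂ν - ∫ x, F x * H (x + τ) ∂ν| ≤
        ε * ∫ x, T.indicator (fun _ ↦ (1 : ℝ)) x * H (x + τ) ∂ν := by
    have hFτ : Integrable (fun x ↦ F (x + τ) * H (x + τ)) ν := by
      have : Integrable (fun x ↦ F x * H x) ν := by simpa using hslice F hFi 0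
      exact this.comp_add_right τ
    rw [← integral_add_right_eq_self (fun x ↦ F x * H x) τ, ← integral_sub hFτ (hslice F hFi τ),
      ← integral_const_mul]
    refine (abs_integral_le_integral_abs).trans (integral_mono_of_nonneg
      (Eventually.of_forall fun x ↦ abs_nonneg _) ((hslice _ hTi τ).const_mul ε)
      (Eventually.of_forall fun x ↦ ?_))
    dsimp only
    rw [← sub_mul, abs_mul, abs_of_nonneg (hH.nonneg _), ← mul_assoc]
    refine mul_le_mul_of_nonneg_right ?_ (hH.nonneg _)
    by_cases hx : x ∈ T
    · simpa [hx] using hFε x τ hτ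
    · simp [hx, hFT x τ hτ hx]
  calc |∫ x, F x * H x ∂ν - ∫ x, F x ∂ν|
      = |∫ τ, (∫ x, F x * H x ∂ν - ∫ x, F x * H (x + τ) ∂ν) ∂ρ| := by
        rw [integral_sub (integrable_const _) (hint F hFi), hmean F hFi]; simp
    _ ≤ ∫ τ, |∫ x, F x * H x ∂ν - ∫ x, F x * H (x + τ) ∂ν| ∂ρ := abs_integral_le_integral_abs
    _ ≤ ∫ τ, ε * ∫ x, T.indicator (fun _ ↦ (1 : ℝ)) x * H (x + τ) ∂ν ∂ρ := by
        refine integral_mono_ae ?_ ((hint _ hTi).const_mul ε) ?_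
        · exact ((integrable_const _).sub (hint F hFi)).abs
        · filter_upwards [hρδ] with τ hτ using hptw τ hτ
    _ = ε * ν.real T := by
        rw [integral_const_mul, hmean _ hTi, integral_indicator hT.measurableSet]; simp

/-- A sequence of finite averages of products of averaging functions, at scales tending to zero,
equidistributes in pairs. -/
theorem tendsto_integral_mul_average {X : Type*} [NormedAddCommGroup X] [ProperSpace X]
    [MeasurableSpace X]
    [BorelSpace X] [SecondCountableTopology X] (ν : Measure X) [SFinite ν]
    [IsFiniteMeasureOnCompacts ν] [ν.IsAddRightInvariant] (P : ℕ → Finset ℕ)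
    (hP : ∀ l, (P l).Nonempty) (h : ℕ → ℕ → X → ℝ) {δ : ℕ → ℝ} (hδ : Tendsto δ atTop (𝓝 0))
    (hh : ∀ l, ∀ q ∈ P l, IsAveraging (δ l) (h l q)) {F : X × X → ℝ} (hF : Continuous F)
    (hFc : HasCompactSupport F) :
    Tendsto (fun l ↦ ∫ p, F p * (((P l).card : ℝ)⁻¹ * (∑ q ∈ P l, h l q p.1) *
      (((P l).card : ℝ)⁻¹ * ∑ q ∈ P l, h l q p.2)) ∂ν.prod ν) atTop (𝓝 (∫ p, F p ∂ν.prod ν)) := by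
  set T : Set (X × X) := Metric.cthickening 1 (tsupport F) with hTdef
  have hT : IsCompact T := hFc.isCompact.cthickening
  have hFu : UniformContinuous F := hFc.uniformContinuous_of_continuous hF
  rw [Metric.tendsto_atTop]
  intro ε hε
  set V : ℝ := (ν.prod ν).real T + 1 with hV
  have hV0 : 0 < V := by positivity
  obtain ⟨η, hη, hFη⟩ := Metric.uniformContinuous_iff.1 hFu (ε / 2 / V) (by positivity)
  obtain ⟨N, hN⟩ := eventually_atTop.1
    (hδ.eventually (gt_mem_nhds (show 0 < min η 1 by positivity)))
  refine ⟨N, fun l hl ↦ ?_⟩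
  have hδη : δ l < η := (hN l hl).trans_le (min_le_left _ _)
  have hδ1 : δ l < 1 := (hN l hl).trans_le (min_le_right _ _)
  have hpair (q q' : ℕ) (hq : q ∈ P l) (hq' : q' ∈ P l) :
      |∫ p, F p * (h l q p.1 * h l q' p.2) ∂ν.prod ν - ∫ p, F p ∂ν.prod ν| ≤ ε / 2 := by
    have := (IsAveraging.prod (hh l q hq) (hh l q' hq')).abs_integral_mul_sub_le (ν.prod ν) hF hFc
      hT (fun x τ hτ hx ↦ ?_) (ε := ε / 2 / V) (fun x τ hτ ↦ ?_)
    · refine this.trans ?_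
      calc ε / 2 / V * (ν.prod ν).real T ≤ ε / 2 / V * V := by gcongr; simp [hV]
        _ = ε / 2 := by field_simp
    · have hx1 : x ∉ tsupport F := fun h ↦ hx (Metric.self_subset_cthickening _ h)
      refine ⟨?_, image_eq_zero_of_notMem_tsupport hx1⟩
      refine image_eq_zero_of_notMem_tsupport fun h ↦ hx ?_
      refine Metric.mem_cthickening_of_dist_le x (x + τ) 1 _ h ?_
      rw [dist_eq_norm]; simpa using hτ.trans hδ1.le
    · have := @hFη (x + τ) x (by rw [dist_eq_norm]; simpa using hτ.trans_lt hδη)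
      rw [Real.dist_eq] at this
      exact this.le
  have hint (q q' : ℕ) (hq : q ∈ P l) (hq' : q' ∈ P l) :
      Integrable (fun p ↦ F p * (h l q p.1 * h l q' p.2)) (ν.prod ν) := by
    refine Continuous.integrable_of_hasCompactSupport ?_ hFc.mul_right
    have := (hh l q hq).continuous
    have := (hh l q' hq').continuous
    fun_prop
  have hc : ((P l).card : ℝ) ≠ 0 := by exact_mod_cast (hP l).card_pos.ne'
  have hexp : ∫ p, F p * (((P l).card : ℝ)⁻¹ * (∑ q ∈ P l, h l q p.1) *
      (((P l).card : ℝ)⁻¹ * ∑ q ∈ P l, h l q p.2)) ∂ν.prod ν - ∫ p, F p ∂ν.prod ν =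
      (((P l).card : ℝ)⁻¹ * ((P l).card : ℝ)⁻¹) * ∑ q ∈ P l, ∑ q' ∈ P l,
        (∫ p, F p * (h l q p.1 * h l q' p.2) ∂ν.prod ν - ∫ p, F p ∂ν.prod ν) := by
    have e (p : X × X) : F p * (((P l).card : ℝ)⁻¹ * (∑ q ∈ P l, h l q p.1) *
        (((P l).card : ℝ)⁻¹ * ∑ q ∈ P l, h l q p.2)) =
        (((P l).card : ℝ)⁻¹ * ((P l).card : ℝ)⁻¹) * ∑ q ∈ P l, ∑ q' ∈ P l,
          F p * (h l q p.1 * h l q' p.2) := by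
      rw [mul_mul_mul_comm, Finset.sum_mul_sum, mul_left_comm, Finset.mul_sum]
      congr 1
      exact Finset.sum_congr rfl fun q _ ↦ Finset.mul_sum _ _ _
    simp_rw [e, Finset.sum_sub_distrib]
    rw [integral_const_mul, integral_finsetSum _ fun q hq ↦ integrable_finsetSum _ fun q' hq' ↦
      hint q q' hq hq', mul_sub]
    congr 1
    · congr 1
      exact Finset.sum_congr rfl fun q hq ↦ integral_finsetSum _ fun q' hq' ↦ hint q q' hq hq'
    · simp only [Finset.sum_const, nsmul_eq_mul]
      field_simp
  rw [Real.dist_eq, hexp, abs_mul, abs_of_nonneg (by positivity)]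
  calc _ ≤ (((P l).card : ℝ)⁻¹ * ((P l).card : ℝ)⁻¹) * ∑ q ∈ P l, ∑ q' ∈ P l, ε / 2 := by
        gcongr
        refine (Finset.abs_sum_le_sum_abs _ _).trans (Finset.sum_le_sum fun q hq ↦ ?_)
        refine (Finset.abs_sum_le_sum_abs _ _).trans (Finset.sum_le_sum fun q' hq' ↦ ?_)
        exact hpair q q' hq hq'
    _ = ε / 2 := by
        simp only [Finset.sum_const, nsmul_eq_mul]
        field_simp
    _ < ε := by linarith

/-! ### Periodic tents -/

/-- The tent function of height `1` on `[-1, 1]`. -/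
def tent (x : ℝ) : ℝ := max 0 (1 - |x|)

lemma continuous_tent : Continuous tent := by unfold tent; fun_prop
lemma tent_nonneg (x : ℝ) : 0 ≤ tent x := le_max_left _ _
lemma tent_le_one (x : ℝ) : tent x ≤ 1 := max_le zero_le_one (by linarith [abs_nonneg x])
lemma tent_eq_zero {x : ℝ} (h : 1 ≤ |x|) : tent x = 0 := max_eq_left (by linarith)
lemma tent_anti {x y : ℝ} (h : |x| ≤ |y|) : tent y ≤ tent x := max_le_max le_rfl (by linarith)

/-- The distance to the nearest integer. -/
noncomputable def distInt (x : ℝ) : ℝ := ‖(x : UnitAddCircle)‖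

lemma distInt_eq (x : ℝ) : distInt x = |x - round x| := UnitAddCircle.norm_eq
lemma continuous_distInt : Continuous distInt :=
  continuous_norm.comp (AddCircle.continuous_mk' 1)
lemma distInt_nonneg (x : ℝ) : 0 ≤ distInt x := norm_nonneg _
lemma distInt_le (x : ℝ) (z : ℤ) : distInt x ≤ |x - z| := by rw [distInt_eq]; exact round_le x z
lemma distInt_periodic : Function.Periodic distInt 1 := fun x ↦ by
  unfold distInt; rw [AddCircle.coe_add_period]

lemma distInt_of_mem_Icc {x : ℝ} (hx : x ∈ Icc (0 : ℝ) 1) : distInt x = min x (1 - x) := by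
  rw [distInt_eq]
  rcases hx.2.lt_or_eq with h | h
  · rw [abs_sub_round_eq_min, Int.fract_eq_self.2 ⟨hx.1, h⟩]
  · subst h; simp

lemma distInt_nat_mul_le (q : ℕ) (x : ℝ) : distInt (q * x) ≤ q * distInt x := by
  refine (distInt_le _ (q * round x)).trans_eq ?_
  rw [distInt_eq]; push_cast
  rw [← mul_sub, abs_mul, Nat.abs_cast]

lemma distInt_nat_mul_of_lt {q : ℕ} {x : ℝ} (h : q * distInt x < 1 / 2) :
    distInt (q * x) = q * distInt x := by
  have h1 : |(q : ℝ) * x - ((q * round x : ℤ) : ℝ)| < 1 / 2 := by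
    push_cast; rw [← mul_sub, abs_mul, Nat.abs_cast, ← distInt_eq]; exact h
  have h2 : round ((q : ℝ) * x) = q * round x := by
    have := abs_sub_round ((q : ℝ) * x)
    have h3 : |((round ((q : ℝ) * x) - q * round x : ℤ) : ℝ)| < 1 := by
      push_cast at h1 ⊢
      calc |(round ((q : ℝ) * x) : ℝ) - q * round x|
          = |-((q : ℝ) * x - round ((q : ℝ) * x)) + ((q : ℝ) * x - q * round x)| := by ring_nf
        _ ≤ _ := abs_add_le _ _
        _ < 1 := by rw [abs_neg]; linarith
    have h4 : |round ((q : ℝ) * x) - q * round x| < 1 := by exact_mod_cast h3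
    have := Int.abs_lt_one_iff.1 h4
    omega
  rw [distInt_eq, h2, distInt_eq]
  push_cast
  rw [← mul_sub, abs_mul, Nat.abs_cast]

/-- The periodic tent of half-width `W` centered at the integers. -/
noncomputable def bump (W x : ℝ) : ℝ := tent (distInt x / W)

lemma continuous_bump (W : ℝ) : Continuous (bump W) :=
  continuous_tent.comp (continuous_distInt.div_const W)
lemma bump_nonneg (W x : ℝ) : 0 ≤ bump W x := tent_nonneg _
lemma bump_le_one (W x : ℝ) : bump W x ≤ 1 := tent_le_one _
lemma bump_periodic (W : ℝ) : Function.Periodic (bump W) 1 := fun x ↦ by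
  unfold bump; rw [distInt_periodic x]
lemma bump_eq_zero {W x : ℝ} (hW : 0 < W) (h : W ≤ distInt x) : bump W x = 0 := by
  refine tent_eq_zero ?_
  rw [abs_of_nonneg (div_nonneg (distInt_nonneg x) hW.le), one_le_div hW]; exact h

lemma bump_of_le {W x : ℝ} (hW : 0 < W) (h : distInt x ≤ W) : bump W x = 1 - distInt x / W := by
  unfold bump tent
  rw [abs_of_nonneg (div_nonneg (distInt_nonneg x) hW.le), max_eq_right]
  rw [sub_nonneg, div_le_one hW]; exact h

lemma integral_bump {W : ℝ} (hW : 0 < W) (hW2 : W ≤ 1 / 2) : ∫ x in (0 : ℝ)..1, bump W x = W := by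
  have hi (a b : ℝ) : IntervalIntegrable (bump W) volume a b :=
    (continuous_bump W).intervalIntegrable a b
  rw [← intervalIntegral.integral_add_adjacent_intervals (hi 0 W) (hi W 1),
    ← intervalIntegral.integral_add_adjacent_intervals (hi W (1 - W)) (hi (1 - W) 1)]
  have h1 : ∫ x in (0 : ℝ)..W, bump W x = ∫ x in (0 : ℝ)..W, (1 - x / W) := by
    refine intervalIntegral.integral_congr fun x hx ↦ ?_
    rw [uIcc_of_le hW.le] at hx
    have e : distInt x = x := by
      rw [distInt_of_mem_Icc ⟨hx.1, by linarith [hx.2]⟩, min_eq_left (by linarith [hx.2])]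
    simp only [bump_of_le hW (e.trans_le hx.2), e]
  have h2 : ∫ x in W..(1 - W), bump W x = ∫ x in W..(1 - W), (0 : ℝ) := by
    refine intervalIntegral.integral_congr fun x hx ↦ ?_
    rw [uIcc_of_le (by linarith)] at hx
    refine bump_eq_zero hW ?_
    rw [distInt_of_mem_Icc ⟨by linarith [hx.1], by linarith [hx.2]⟩]
    exact le_min hx.1 (by linarith [hx.2])
  have h3 : ∫ x in (1 - W)..1, bump W x = ∫ x in (1 - W)..1, (1 - (1 - x) / W) := by
    refine intervalIntegral.integral_congr fun x hx ↦ ?_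
    rw [uIcc_of_le (by linarith)] at hx
    have e : distInt x = 1 - x := by
      rw [distInt_of_mem_Icc ⟨by linarith [hx.1], hx.2⟩, min_eq_right (by linarith [hx.1])]
    simp only [bump_of_le hW (e.trans_le (by linarith [hx.1])), e]
  have h4 : ∫ x in (1 - W)..1, (1 - (1 - x) / W) = ∫ x in (0 : ℝ)..W, (1 - x / W) := by
    rw [intervalIntegral.integral_comp_sub_left (fun x ↦ 1 - x / W) 1]
    simp
  have h5 : ∫ x in (0 : ℝ)..W, (1 - x / W) = W / 2 := by
    rw [intervalIntegral.integral_sub (f := fun _ ↦ (1 : ℝ)) (g := fun x ↦ x / W)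
      intervalIntegrable_const ((continuous_id.div_const W).intervalIntegrable 0 W),
      intervalIntegral.integral_div]
    simp only [integral_id, intervalIntegral.integral_const, smul_eq_mul]
    field_simp
    ring
  rw [h1, h2, h3, h4, h5]
  simp

lemma integral_bump_nat_mul {W : ℝ} (hW : 0 < W) (hW2 : W ≤ 1 / 2) {q : ℕ} (hq : 0 < q) :
    ∫ x in (0 : ℝ)..1, bump W (q * x) = W := by
  have hq' : (q : ℝ) ≠ 0 := by exact_mod_cast hq.ne'
  rw [intervalIntegral.integral_comp_mul_left (fun x ↦ bump W x) hq']
  have := (bump_periodic W).intervalIntegral_add_zsmul_eq (q : ℤ) 0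
  simp only [zero_add, integral_bump hW hW2] at this
  simp only [natCast_zsmul, nsmul_eq_mul, mul_one] at this
  rw [mul_zero, mul_one, this fun a b ↦ (continuous_bump W).intervalIntegrable a b, smul_eq_mul]
  field_simp

/-- The periodic tent of half-width `W / q` and mean `1`, centered at the fractions `p / q` with
`p` not divisible by `q`. -/
noncomputable def fareyBump (W : ℝ) (q : ℕ) (x : ℝ) : ℝ :=
  (W * (1 - (q : ℝ)⁻¹))⁻¹ * (bump W (q * x) - bump (W / q) x)

lemma continuous_fareyBump (W : ℝ) (q : ℕ) : Continuous (fareyBump W q) := by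
  unfold fareyBump
  have := continuous_bump W
  have := continuous_bump (W / q)
  fun_prop

lemma fareyBump_periodic (W : ℝ) (q : ℕ) : Function.Periodic (fareyBump W q) 1 := fun x ↦ by
  unfold fareyBump
  have h : bump W (q * x + q) = bump W (q * x) := by
    simpa using (bump_periodic W).nat_mul q ((q : ℝ) * x)
  rw [bump_periodic, mul_add, mul_one, h]

lemma one_half_le_one_sub_inv {q : ℕ} (hq : 2 ≤ q) : (1 : ℝ) / 2 ≤ 1 - (q : ℝ)⁻¹ := by
  have : (q : ℝ)⁻¹ ≤ 2⁻¹ := inv_anti₀ (by norm_num) (by exact_mod_cast hq)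
  linarith

lemma fareyBump_nonneg {W : ℝ} (hW : 0 < W) {q : ℕ} (hq : 2 ≤ q) (x : ℝ) :
    0 ≤ fareyBump W q x := by
  have h1 := one_half_le_one_sub_inv hq
  refine mul_nonneg (inv_nonneg.2 (mul_nonneg hW.le (by linarith))) (sub_nonneg.2 ?_)
  refine tent_anti ?_
  have hq0 : (0 : ℝ) < q := by exact_mod_cast (by omega : 0 < q)
  rw [abs_of_nonneg (div_nonneg (distInt_nonneg _) hW.le),
    abs_of_nonneg (div_nonneg (distInt_nonneg _) (by positivity)), div_div_eq_mul_div,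
    mul_comm _ (q : ℝ)]
  exact div_le_div_of_nonneg_right (distInt_nat_mul_le q x) hW.le

lemma fareyBump_le {W : ℝ} (hW : 0 < W) {q : ℕ} (hq : 2 ≤ q) (x : ℝ) :
    fareyBump W q x ≤ 2 / W := by
  have h1 := one_half_le_one_sub_inv hq
  unfold fareyBump
  calc (W * (1 - (q : ℝ)⁻¹))⁻¹ * (bump W (q * x) - bump (W / q) x)
      ≤ (W * (1 / 2))⁻¹ * 1 := by
        gcongr
        · exact sub_nonneg.2 (by
            by_contra h
            push Not at h
            have := fareyBump_nonneg hW hq x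
            unfold fareyBump at this
            have h2 : (W * (1 - (q : ℝ)⁻¹))⁻¹ * (bump W (q * x) - bump (W / q) x) < 0 :=
              mul_neg_of_pos_of_neg (inv_pos.2 (mul_pos hW (by linarith))) (by linarith)
            linarith)
        · linarith [bump_le_one W (q * x), bump_nonneg (W / q) x]
    _ = 2 / W := by field_simp

lemma integral_fareyBump {W : ℝ} (hW : 0 < W) (hW2 : W ≤ 1 / 2) {q : ℕ} (hq : 2 ≤ q) :
    ∫ x in (0 : ℝ)..1, fareyBump W q x = 1 := by
  have hq0 : (0 : ℝ) < q := by exact_mod_cast (by omega : 0 < q)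
  have hq1 : (1 : ℝ) ≤ q := by exact_mod_cast (by omega : 1 ≤ q)
  have h1 := one_half_le_one_sub_inv hq
  unfold fareyBump
  rw [intervalIntegral.integral_const_mul, intervalIntegral.integral_sub,
    integral_bump_nat_mul hW hW2 (by omega), integral_bump (by positivity)
      ((div_le_self hW.le hq1).trans hW2)]
  · have : W - W / q = W * (1 - (q : ℝ)⁻¹) := by ring
    rw [this, inv_mul_cancel₀ (mul_pos hW (by linarith)).ne']
  · exact ((continuous_bump W).comp (continuous_const_mul _)).intervalIntegrable 0 1
  · exact (continuous_bump _).intervalIntegrable 0 1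

/-- Close to the integers the two tents in `fareyBump` cancel. -/
lemma le_of_fareyBump_ne_zero {W : ℝ} (hW : 0 < W) {q : ℕ} (hq : 0 < q) {x : ℝ}
    (h : fareyBump W q x ≠ 0) : distInt (q * x) ≤ W ∧ 1 / 2 ≤ q * distInt x := by
  have hq0 : (0 : ℝ) < q := by exact_mod_cast hq
  constructor
  · by_contra h1
    push Not at h1
    refine h ?_
    have h2 := distInt_nat_mul_le q x
    rw [fareyBump, bump_eq_zero hW h1.le, bump_eq_zero (by positivity), sub_self, mul_zero]
    rw [div_le_iff₀ hq0]; linarith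
  · by_contra h1
    push Not at h1
    refine h ?_
    have h2 := distInt_nat_mul_of_lt h1
    rw [fareyBump, bump, bump, h2, div_div_eq_mul_div, mul_comm (q : ℝ) (distInt x), sub_self,
      mul_zero]

/-! ### Pair correlations of combs -/

/-- The tents of half-width `w` and total mass `1` per period, centered at the points of
`Λ⁻¹ ℤ`. -/
noncomputable def combBump (Λ w x : ℝ) : ℝ := (Λ * w)⁻¹ * bump (Λ * w) (Λ * x)

lemma continuous_combBump (Λ w : ℝ) : Continuous (combBump Λ w) := by
  unfold combBump; have := continuous_bump (Λ * w); fun_prop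

lemma combBump_nonneg {Λ w : ℝ} (hΛ : 0 < Λ) (hw : 0 < w) (x : ℝ) : 0 ≤ combBump Λ w x :=
  mul_nonneg (by positivity) (bump_nonneg _ _)

/-- The interval of radius `w` centered at the `p`-th point of `Λ⁻¹ ℕ`. -/
def combInterval (Λ w : ℝ) (p : ℕ) : Set ℝ := Icc (p / Λ - w) (p / Λ + w)

lemma combBump_le_sum {Λ w : ℝ} (hΛ : 0 < Λ) (hw : 0 < w) {x : ℝ} (hx : x ∈ Icc (0 : ℝ) 1) :
    combBump Λ w x ≤ (Λ * w)⁻¹ * ∑ p ∈ Finset.range (⌈Λ⌉₊ + 1),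
      (combInterval Λ w p).indicator (fun _ ↦ (1 : ℝ)) x := by
  unfold combBump
  refine mul_le_mul_of_nonneg_left ?_ (by positivity)
  have hs : ∀ p ∈ Finset.range (⌈Λ⌉₊ + 1),
      0 ≤ (combInterval Λ w p).indicator (fun _ ↦ (1 : ℝ)) x :=
    fun p _ ↦ Set.indicator_nonneg (fun _ _ ↦ zero_le_one) x
  by_cases h : Λ * w ≤ distInt (Λ * x)
  · rw [bump_eq_zero (by positivity) h]; exact Finset.sum_nonneg hs
  push Not at h
  have hΛx : 0 ≤ Λ * x := mul_nonneg hΛ.le hx.1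
  have hr0 : 0 ≤ round (Λ * x) := by rw [round_eq]; exact Int.floor_nonneg.2 (by linarith)
  obtain ⟨p, hp⟩ := Int.eq_ofNat_of_zero_le hr0
  rw [distInt_eq, hp, Int.cast_natCast] at h
  have hpm : p ∈ Finset.range (⌈Λ⌉₊ + 1) := by
    rw [Finset.mem_range, Nat.lt_succ_iff]
    have h1 := abs_sub_round (Λ * x)
    rw [hp, Int.cast_natCast] at h1
    have h2 : (p : ℝ) < ⌈Λ⌉₊ + 1 := by
      have := (abs_le.1 h1).1
      have := Nat.le_ceil Λ
      have : Λ * x ≤ Λ := mul_le_of_le_one_right hΛ.le hx.2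
      linarith
    exact Nat.lt_succ_iff.1 (by exact_mod_cast h2)
  refine (bump_le_one _ _).trans (le_trans ?_ (Finset.single_le_sum hs hpm))
  rw [Set.indicator_of_mem]
  have h3 : |x - p / Λ| < w := by
    have e : Λ * x - p = Λ * (x - p / Λ) := by field_simp
    rw [e, abs_mul, abs_of_pos hΛ] at h
    exact lt_of_mul_lt_mul_left h hΛ.le
  rw [abs_lt] at h3
  exact ⟨by linarith [h3.1], by linarith [h3.2]⟩

/-- The pairs of points of two combs at distance at most `r`. -/
noncomputable def closeIndices (Λ Λ' r : ℝ) : Finset (ℕ × ℕ) :=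
  (Finset.range (⌈Λ⌉₊ + 1) ×ˢ Finset.range (⌈Λ'⌉₊ + 1)).filter
    fun P ↦ |(P.1 : ℝ) / Λ - P.2 / Λ'| ≤ r

/-- The pairs of points of two comb intervals at distance at most `ρ`. -/
def closePoints (Λ Λ' w ρ : ℝ) (P : ℕ × ℕ) : Set (ℝ × ℝ) :=
  (combInterval Λ w P.1 ×ˢ combInterval Λ' w P.2) ∩ {z | |z.1 - z.2| ≤ ρ}

lemma measurableSet_closePoints (Λ Λ' w ρ : ℝ) (P : ℕ × ℕ) :
    MeasurableSet (closePoints Λ Λ' w ρ P) :=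
  (measurableSet_Icc.prod measurableSet_Icc).inter
    (measurableSet_le (by fun_prop) measurable_const)

lemma closePoints_eq_empty {Λ Λ' w ρ : ℝ} {P : ℕ × ℕ}
    (h : ¬ |(P.1 : ℝ) / Λ - P.2 / Λ'| ≤ 2 * w + ρ) : closePoints Λ Λ' w ρ P = ∅ := by
  rw [Set.eq_empty_iff_forall_notMem]
  rintro ⟨x, y⟩ ⟨⟨hx, hy⟩, hz⟩
  refine h ?_
  simp only [combInterval, mem_Icc] at hx hy
  have hz' : |x - y| ≤ ρ := hz
  rw [abs_le] at hz' ⊢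
  constructor <;> linarith [hx.1, hx.2, hy.1, hy.2, hz'.1, hz'.2]

lemma volume_closePoints_le {Λ Λ' w ρ : ℝ} (hw : 0 < w) (hρ : 0 < ρ) (P : ℕ × ℕ) :
    (volume : Measure (ℝ × ℝ)).real (closePoints Λ Λ' w ρ P) ≤ 4 * w * min w ρ := by
  have hmin : 0 < min w ρ := lt_min hw hρ
  have h : (volume : Measure (ℝ × ℝ)) (closePoints Λ Λ' w ρ P) ≤
      ENNReal.ofReal (4 * w * min w ρ) := by
    rw [Measure.volume_eq_prod, Measure.prod_apply (measurableSet_closePoints Λ Λ' w ρ P)]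
    calc ∫⁻ x, volume (Prod.mk x ⁻¹' closePoints Λ Λ' w ρ P)
        ≤ ∫⁻ x, (combInterval Λ w P.1).indicator (fun _ ↦ ENNReal.ofReal (2 * min w ρ)) x := by
          refine lintegral_mono fun x ↦ ?_
          by_cases hx : x ∈ combInterval Λ w P.1
          · rw [Set.indicator_of_mem hx]
            rcases le_total w ρ with h | h
            · rw [min_eq_left h]
              calc _ ≤ volume (combInterval Λ' w P.2) :=
                    measure_mono fun y hy ↦ hy.1.2
                _ = _ := by
                    rw [combInterval, Real.volume_Icc]; congr 1; ring
            · rw [min_eq_right h]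
              calc _ ≤ volume (Icc (x - ρ) (x + ρ)) := measure_mono fun y hy ↦ by
                    have : |x - y| ≤ ρ := hy.2
                    rw [abs_le] at this
                    exact ⟨by linarith [this.2], by linarith [this.1]⟩
                _ = _ := by rw [Real.volume_Icc]; congr 1; ring
          · rw [Set.indicator_of_notMem hx]
            have : Prod.mk x ⁻¹' closePoints Λ Λ' w ρ P = ∅ := by
              rw [Set.eq_empty_iff_forall_notMem]
              exact fun y hy ↦ hx hy.1.1
            rw [this, measure_empty]
      _ = ENNReal.ofReal (4 * w * min w ρ) := by
          rw [combInterval, lintegral_indicator_const measurableSet_Icc, Real.volume_Icc,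
            ← ENNReal.ofReal_mul (by positivity)]
          congr 1; ring
  exact ENNReal.toReal_le_of_le_ofReal (by positivity) h

/-- The correlation of two combs is controlled by the number of pairs of close centers. -/
lemma integral_combBump_mul_le {Λ Λ' w ρ : ℝ} (hΛ : 0 < Λ) (hΛ' : 0 < Λ') (hw : 0 < w)
    (hρ : 0 < ρ) :
    ∫ z in Icc (0 : ℝ) 1 ×ˢ Icc (0 : ℝ) 1,
      tent ((z.1 - z.2) / ρ) * (combBump Λ w z.1 * combBump Λ' w z.2) ≤
      ((Λ * w)⁻¹ * (Λ' * w)⁻¹) * (4 * w * min w ρ * (closeIndices Λ Λ' (2 * w + ρ)).card) := by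
  set I := Finset.range (⌈Λ⌉₊ + 1) ×ˢ Finset.range (⌈Λ'⌉₊ + 1)
  have hfin (P : ℕ × ℕ) : (volume : Measure (ℝ × ℝ)) (closePoints Λ Λ' w ρ P) ≠ ⊤ :=
    ((measure_mono Set.inter_subset_left).trans_lt
      (isCompact_Icc.prod isCompact_Icc).measure_lt_top).ne
  have hind (P : ℕ × ℕ) : Integrable
      ((closePoints Λ Λ' w ρ P).indicator fun _ ↦ (1 : ℝ)) (volume : Measure (ℝ × ℝ)) :=
    (integrable_indicator_iff (measurableSet_closePoints Λ Λ' w ρ P)).2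
      (integrableOn_const (hfin P))
  have hc : IsCompact (Icc (0 : ℝ) 1 ×ˢ Icc (0 : ℝ) 1) := isCompact_Icc.prod isCompact_Icc
  have hsumint : Integrable (fun z ↦ ((Λ * w)⁻¹ * (Λ' * w)⁻¹) *
      ∑ P ∈ I, (closePoints Λ Λ' w ρ P).indicator (fun _ ↦ (1 : ℝ)) z)
      (volume : Measure (ℝ × ℝ)) :=
    (integrable_finsetSum _ fun P _ ↦ hind P).const_mul _
  calc _ ≤ ∫ z in Icc (0 : ℝ) 1 ×ˢ Icc (0 : ℝ) 1, ((Λ * w)⁻¹ * (Λ' * w)⁻¹) *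
        ∑ P ∈ I, (closePoints Λ Λ' w ρ P).indicator (fun _ ↦ (1 : ℝ)) z := by
        refine setIntegral_mono_on ?_ hsumint.integrableOn hc.measurableSet fun z hz ↦ ?_
        · refine ContinuousOn.integrableOn_compact hc (Continuous.continuousOn ?_)
          have := continuous_tent; have := continuous_combBump Λ w
          have := continuous_combBump Λ' w
          fun_prop
        · have h1 := combBump_le_sum hΛ hw hz.1
          have h2 := combBump_le_sum hΛ' hw hz.2
          have hnn (P : ℕ × ℕ) : 0 ≤ (closePoints Λ Λ' w ρ P).indicator (fun _ ↦ (1 : ℝ)) z :=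
            Set.indicator_nonneg (fun _ _ ↦ zero_le_one) z
          by_cases hzρ : |z.1 - z.2| ≤ ρ
          · calc tent ((z.1 - z.2) / ρ) * (combBump Λ w z.1 * combBump Λ' w z.2)
                ≤ combBump Λ w z.1 * combBump Λ' w z.2 :=
                  mul_le_of_le_one_left (mul_nonneg (combBump_nonneg hΛ hw _)
                    (combBump_nonneg hΛ' hw _)) (tent_le_one _)
              _ ≤ _ := mul_le_mul h1 h2 (combBump_nonneg hΛ' hw _)
                  ((combBump_nonneg hΛ hw _).trans h1)
              _ = _ := by
                  rw [mul_mul_mul_comm, Finset.sum_mul_sum, ← Finset.sum_product']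
                  congr 1
                  refine Finset.sum_congr rfl fun P _ ↦ ?_
                  have hmem : z ∈ closePoints Λ Λ' w ρ P ↔
                      z.1 ∈ combInterval Λ w P.1 ∧ z.2 ∈ combInterval Λ' w P.2 :=
                    ⟨fun h ↦ h.1, fun h ↦ ⟨h, hzρ⟩⟩
                  by_cases a : z.1 ∈ combInterval Λ w P.1 <;>
                    by_cases b : z.2 ∈ combInterval Λ' w P.2 <;>
                    simp [Set.indicator, hmem, a, b]
          · have : tent ((z.1 - z.2) / ρ) = 0 := by
              refine tent_eq_zero ?_
              rw [abs_div, abs_of_pos hρ, one_le_div hρ]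
              exact (not_le.1 hzρ).le
            rw [this, zero_mul]
            exact mul_nonneg (by positivity) (Finset.sum_nonneg fun P _ ↦ hnn P)
    _ ≤ ∫ z, ((Λ * w)⁻¹ * (Λ' * w)⁻¹) *
        ∑ P ∈ I, (closePoints Λ Λ' w ρ P).indicator (fun _ ↦ (1 : ℝ)) z :=
        setIntegral_le_integral hsumint (Eventually.of_forall fun z ↦
          mul_nonneg (by positivity) (Finset.sum_nonneg fun P _ ↦
            Set.indicator_nonneg (fun _ _ ↦ zero_le_one) z))
    _ = ((Λ * w)⁻¹ * (Λ' * w)⁻¹) *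
        ∑ P ∈ I, (volume : Measure (ℝ × ℝ)).real (closePoints Λ Λ' w ρ P) := by
        rw [integral_const_mul, integral_finsetSum _ fun P _ ↦ hind P]
        congr 1
        refine Finset.sum_congr rfl fun P _ ↦ ?_
        rw [integral_indicator (measurableSet_closePoints Λ Λ' w ρ P)]; simp
    _ ≤ _ := by
        refine mul_le_mul_of_nonneg_left ?_ (by positivity)
        rw [closeIndices, ← Finset.sum_filter_add_sum_filter_not I
          (fun P ↦ |(P.1 : ℝ) / Λ - P.2 / Λ'| ≤ 2 * w + ρ)]
        rw [Finset.sum_eq_zero (s := I.filter fun P ↦ ¬ _) fun P hP ↦ by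
          rw [closePoints_eq_empty (Finset.mem_filter.1 hP).2]; simp, add_zero,
          mul_comm (4 * w * min w ρ), ← nsmul_eq_mul]
        exact Finset.sum_le_card_nsmul _ _ _ fun P _ ↦ volume_closePoints_le hw hρ P

/-- For coprime `q` and `q'` every value of `p * q' - p' * q` is taken at most
once per period, that is, per range of `q` consecutive values of `p`. -/
lemma card_filter_coprime_le {q q' : ℕ} (hq : 0 < q) (hqq : Nat.Coprime q q') (N N' : ℕ) {T : ℝ}
    (hT : 0 ≤ T) (S : Finset (ℕ × ℕ))
    (hS : ∀ P ∈ S, P.1 ≤ N ∧ P.2 ≤ N' ∧ |(P.1 : ℝ) * q' - P.2 * q| ≤ T) :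
    (S.card : ℝ) ≤ (2 * T + 1) * (N / q + 1) := by
  have hinj : S.card ≤ (Finset.Icc (-⌊T⌋) ⌊T⌋ ×ˢ Finset.range (N / q + 1)).card := by
    refine Finset.card_le_card_of_injOn
      (fun P ↦ ((P.1 : ℤ) * q' - P.2 * q, P.1 / q)) (fun P hP ↦ ?_) ?_
    · obtain ⟨h1, -, h3⟩ := hS P hP
      simp only [Finset.coe_product, Set.mem_prod, Finset.mem_coe, Finset.mem_Icc,
        Finset.mem_range, Nat.lt_succ_iff]
      rw [abs_le] at h3
      refine ⟨⟨?_, ?_⟩, Nat.div_le_div_right h1⟩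
      · have : -((P.1 : ℤ) * q' - P.2 * q) ≤ ⌊T⌋ := Int.le_floor.2 (by push_cast; linarith [h3.1])
        linarith
      · exact Int.le_floor.2 (by push_cast; linarith [h3.2])
    · rintro ⟨p, p'⟩ - ⟨r, r'⟩ - h
      simp only [Prod.mk.injEq] at h
      obtain ⟨h1, h2⟩ := h
      have hdvd : (q : ℤ) ∣ ((p : ℤ) - r) := by
        have h3 : (q : ℤ) ∣ ((p : ℤ) - r) * q' := ⟨(p' : ℤ) - r', by linarith⟩
        exact IsCoprime.dvd_of_dvd_mul_right (Nat.isCoprime_iff_coprime.2 hqq) h3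
      have hmod : p % q = r % q := by
        have := (Int.modEq_iff_dvd.2 hdvd)
        exact ((Int.natCast_modEq_iff.1 this)).symm
      have hp : p = r := by rw [← Nat.div_add_mod p q, ← Nat.div_add_mod r q, h2, hmod]
      subst hp
      have hq0 : (q : ℤ) ≠ 0 := by exact_mod_cast hq.ne'
      have : (p' : ℤ) = r' := mul_right_cancel₀ hq0 (by linarith)
      simp only [Prod.mk.injEq, true_and]
      exact_mod_cast this
  rw [Finset.card_product, Int.card_Icc, Finset.card_range] at hinj
  have hfl : (0 : ℤ) ≤ ⌊T⌋ := Int.floor_nonneg.2 hT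
  have e : (((⌊T⌋ + 1 - -⌊T⌋).toNat : ℕ) : ℝ) = 2 * ⌊T⌋ + 1 := by
    have : (((⌊T⌋ + 1 - -⌊T⌋).toNat : ℕ) : ℤ) = 2 * ⌊T⌋ + 1 := by
      rw [Int.toNat_of_nonneg (by linarith)]; ring
    exact_mod_cast this
  calc (S.card : ℝ) ≤ (((⌊T⌋ + 1 - -⌊T⌋).toNat * (N / q + 1) : ℕ) : ℝ) := by exact_mod_cast hinj
    _ = (2 * ⌊T⌋ + 1) * ((N / q : ℕ) + 1) := by push_cast [e]; ring
    _ ≤ _ := by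
      have h1 := Int.floor_le T
      have h2 : ((N / q : ℕ) : ℝ) ≤ N / q := Nat.cast_div_le
      gcongr

/-- Correlation of two combs with coprime denominators. -/
lemma integral_combBump_coprime_le {q q' : ℕ} (hq : 0 < q) (hq' : 0 < q')
    (hqq : Nat.Coprime q q') {D w ρ : ℝ} (hD : 1 ≤ D) (hw : 0 < w) (hρ : 0 < ρ) :
    ∫ z in Icc (0 : ℝ) 1 ×ˢ Icc (0 : ℝ) 1,
      tent ((z.1 - z.2) / ρ) * (combBump (q * D) w z.1 * combBump (q' * D) w z.2) ≤
      48 * (min w ρ / w) * (w + ρ + 1 / (q * q' * D)) := by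
  have hq0 : (0 : ℝ) < q := by exact_mod_cast hq
  have hq1 : (1 : ℝ) ≤ q := by exact_mod_cast hq
  have hq0' : (0 : ℝ) < q' := by exact_mod_cast hq'
  have hD0 : 0 < D := by linarith
  have hmin : 0 < min w ρ := lt_min hw hρ
  refine (integral_combBump_mul_le (by positivity) (by positivity) hw hρ).trans ?_
  have hcard := card_filter_coprime_le hq hqq ⌈q * D⌉₊ ⌈q' * D⌉₊
    (T := q * q' * D * (2 * w + ρ)) (by positivity)
    (closeIndices (q * D) (q' * D) (2 * w + ρ)) fun P hP ↦ by
      rw [closeIndices, Finset.mem_filter, Finset.mem_product, Finset.mem_range,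
        Finset.mem_range] at hP
      refine ⟨by omega, by omega, ?_⟩
      have e : (P.1 : ℝ) * q' - P.2 * q = (q * q' * D) * (P.1 / (q * D) - P.2 / (q' * D)) := by
        field_simp
      rw [e, abs_mul, abs_of_pos (by positivity)]
      exact mul_le_mul_of_nonneg_left hP.2 (by positivity)
  have hN : (⌈q * D⌉₊ : ℝ) / q + 1 ≤ 3 * D := by
    have h1 : (⌈q * D⌉₊ : ℝ) ≤ q * D + q := by
      have := (Nat.ceil_lt_add_one (show 0 ≤ q * D by positivity)).le
      linarith
    have h2 : (⌈q * D⌉₊ : ℝ) / q ≤ D + 1 := by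
      rw [div_le_iff₀ hq0]; linarith
    linarith
  calc _ ≤ ((q * D * w)⁻¹ * (q' * D * w)⁻¹) * (4 * w * min w ρ *
        ((2 * (q * q' * D * (2 * w + ρ)) + 1) * (3 * D))) := by
        gcongr
        refine hcard.trans ?_
        gcongr
    _ = 12 * (min w ρ / w) * (4 * w + 2 * ρ + 1 / (q * q' * D)) := by
        field_simp
        ring
    _ ≤ 12 * (min w ρ / w) * (4 * (w + ρ + 1 / (q * q' * D))) := by
        have : 0 < 1 / ((q : ℝ) * q' * D) := by positivity
        gcongr
        linarith
    _ = _ := by ring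

/-- Correlation of a comb with itself. -/
lemma integral_combBump_self_le {Λ w ρ : ℝ} (hΛ : 1 ≤ Λ) (hw : 0 < w) (hρ : 0 < ρ) :
    ∫ z in Icc (0 : ℝ) 1 ×ˢ Icc (0 : ℝ) 1,
      tent ((z.1 - z.2) / ρ) * (combBump Λ w z.1 * combBump Λ w z.2) ≤
      48 * (min w ρ / w) * (w + ρ + 1 / Λ) := by
  have hΛ0 : 0 < Λ := by linarith
  have hmin : 0 < min w ρ := lt_min hw hρ
  refine (integral_combBump_mul_le hΛ0 hΛ0 hw hρ).trans ?_
  have hcard := card_filter_coprime_le one_pos (Nat.coprime_one_left 1) ⌈Λ⌉₊ ⌈Λ⌉₊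
    (T := Λ * (2 * w + ρ)) (by positivity)
    (closeIndices Λ Λ (2 * w + ρ)) fun P hP ↦ by
      rw [closeIndices, Finset.mem_filter, Finset.mem_product, Finset.mem_range,
        Finset.mem_range] at hP
      refine ⟨by omega, by omega, ?_⟩
      have e : (P.1 : ℝ) * (1 : ℕ) - P.2 * (1 : ℕ) = Λ * (P.1 / Λ - P.2 / Λ) := by
        field_simp; simp
      rw [e, abs_mul, abs_of_pos (by positivity)]
      exact mul_le_mul_of_nonneg_left hP.2 (by positivity)
  have hN : (⌈Λ⌉₊ : ℝ) / (1 : ℕ) + 1 ≤ 3 * Λ := by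
    have := (Nat.ceil_lt_add_one hΛ0.le).le
    simp only [Nat.cast_one, div_one]
    linarith
  calc _ ≤ ((Λ * w)⁻¹ * (Λ * w)⁻¹) * (4 * w * min w ρ *
        ((2 * (Λ * (2 * w + ρ)) + 1) * (3 * Λ))) := by
        gcongr
        refine hcard.trans ?_
        gcongr
    _ = 12 * (min w ρ / w) * (4 * w + 2 * ρ + 1 / Λ) := by
        field_simp
        ring
    _ ≤ 12 * (min w ρ / w) * (4 * (w + ρ + 1 / Λ)) := by
        have : 0 < 1 / Λ := by positivity
        gcongr
        linarith
    _ = _ := by ring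

/-- Functions bounded by `M` have correlation `O(ρ)` at scale `ρ`. -/
lemma integral_tent_mul_le {u v : ℝ → ℝ} (hu : Continuous u) (hv : Continuous v)
    (hu0 : ∀ x, 0 ≤ u x) (hv0 : ∀ x, 0 ≤ v x) {M ρ : ℝ} (huM : ∀ x, u x ≤ M) (hvM : ∀ x, v x ≤ M)
    (hρ : 0 < ρ) :
    ∫ z in Icc (0 : ℝ) 1 ×ˢ Icc (0 : ℝ) 1, tent ((z.1 - z.2) / ρ) * (u z.1 * v z.2) ≤
      M * M * (2 * ρ) := by
  have hM : 0 ≤ M := (hu0 0).trans (huM 0)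
  have hc : IsCompact (Icc (0 : ℝ) 1 ×ˢ Icc (0 : ℝ) 1) := isCompact_Icc.prod isCompact_Icc
  have hvol : (volume : Measure (ℝ × ℝ)).real
      ((Icc (0 : ℝ) 1 ×ˢ Icc (0 : ℝ) 1) ∩ {z | |z.1 - z.2| ≤ ρ}) ≤ 2 * ρ := by
    refine ENNReal.toReal_le_of_le_ofReal (by positivity) ?_
    have hm : MeasurableSet
        ((Icc (0 : ℝ) 1 ×ˢ Icc (0 : ℝ) 1) ∩ {z : ℝ × ℝ | |z.1 - z.2| ≤ ρ}) :=
      hc.measurableSet.inter (measurableSet_le (by fun_prop) measurable_const)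
    rw [Measure.volume_eq_prod, Measure.prod_apply hm]
    calc _ ≤ ∫⁻ x, (Icc (0 : ℝ) 1).indicator (fun _ ↦ ENNReal.ofReal (2 * ρ)) x := by
          refine lintegral_mono fun x ↦ ?_
          by_cases hx : x ∈ Icc (0 : ℝ) 1
          · rw [Set.indicator_of_mem hx]
            calc _ ≤ volume (Icc (x - ρ) (x + ρ)) := measure_mono fun y hy ↦ by
                  have : |x - y| ≤ ρ := hy.2
                  rw [abs_le] at this
                  exact ⟨by linarith [this.2], by linarith [this.1]⟩
              _ = _ := by rw [Real.volume_Icc]; congr 1; ring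
          · rw [Set.indicator_of_notMem hx]
            refine le_of_eq (measure_mono_null (t := ∅) (fun y hy ↦ hx hy.1.1) measure_empty)
      _ = _ := by
          rw [lintegral_indicator_const measurableSet_Icc, Real.volume_Icc]; simp
  calc _ ≤ ∫ z in Icc (0 : ℝ) 1 ×ˢ Icc (0 : ℝ) 1,
        {z : ℝ × ℝ | |z.1 - z.2| ≤ ρ}.indicator (fun _ ↦ M * M) z := by
        refine setIntegral_mono_on ?_ ?_ hc.measurableSet fun z hz ↦ ?_
        · refine ContinuousOn.integrableOn_compact hc (Continuous.continuousOn ?_)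
          have := continuous_tent
          fun_prop
        · exact (integrableOn_const hc.measure_lt_top.ne).indicator
            (measurableSet_le (by fun_prop) measurable_const)
        · by_cases hzρ : |z.1 - z.2| ≤ ρ
          · rw [Set.indicator_of_mem (show z ∈ {z : ℝ × ℝ | |z.1 - z.2| ≤ ρ} from hzρ)]
            refine (mul_le_of_le_one_left (mul_nonneg (hu0 _) (hv0 _)) (tent_le_one _)).trans ?_
            exact mul_le_mul (huM _) (hvM _) (hv0 _) hM
          · have : tent ((z.1 - z.2) / ρ) = 0 := by
              refine tent_eq_zero ?_
              rw [abs_div, abs_of_pos hρ, one_le_div hρ]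
              exact (not_le.1 hzρ).le
            rw [this, zero_mul]
            exact Set.indicator_nonneg (fun _ _ ↦ mul_nonneg hM hM) z
    _ = M * M * (volume : Measure (ℝ × ℝ)).real
      ((Icc (0 : ℝ) 1 ×ˢ Icc (0 : ℝ) 1) ∩ {z | |z.1 - z.2| ≤ ρ}) := by
        rw [setIntegral_indicator (measurableSet_le (by fun_prop) measurable_const)]
        simp [mul_comm]
    _ ≤ _ := by gcongr

/-! ### Primes in short multiplicative intervals -/

/-- The primes in the interval `(x, y]`. -/
noncomputable def primesIoc (x y : ℝ) : Finset ℕ :=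
  (Finset.range (⌊y⌋₊ + 1)).filter fun p ↦ p.Prime ∧ x < p

lemma mem_primesIoc {x y : ℝ} (hy : 0 ≤ y) {p : ℕ} :
    p ∈ primesIoc x y ↔ p.Prime ∧ x < p ∧ (p : ℝ) ≤ y := by
  rw [primesIoc, Finset.mem_filter, Finset.mem_range, Nat.lt_succ_iff, Nat.le_floor_iff hy]
  tauto

lemma primeCounting_le_add_card_primesIoc (x : ℝ) {y : ℝ} (hy : 0 ≤ y) :
    Nat.primeCounting ⌊y⌋₊ ≤ Nat.primeCounting ⌊x⌋₊ + (primesIoc x y).card := by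
  simp only [Nat.primeCounting, Nat.primeCounting', Nat.count_eq_card_filter_range]
  refine (Finset.card_le_card (t := (Finset.range (⌊x⌋₊ + 1)).filter Nat.Prime ∪ primesIoc x y)
    fun p hp ↦ ?_).trans (Finset.card_union_le _ _)
  rw [Finset.mem_filter, Finset.mem_range, Nat.lt_succ_iff, Nat.le_floor_iff hy] at hp
  rw [Finset.mem_union, mem_primesIoc hy, Finset.mem_filter, Finset.mem_range, Nat.lt_succ_iff]
  by_cases h : x < p
  · exact Or.inr ⟨hp.2, h, hp.1⟩
  · exact Or.inl ⟨Nat.le_floor (not_lt.1 h), hp.2⟩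

/-- A weak form of Chebyshev's lower bound. -/
lemma eventually_rpow_le_primeCounting {η : ℝ} (hη : 0 < η) :
    ∀ᶠ x : ℝ in atTop, x ^ (1 - η) ≤ Nat.primeCounting ⌊x⌋₊ := by
  have h1 := (isLittleO_log_rpow_atTop hη).bound (show (0 : ℝ) < 1 / 8 by norm_num)
  have h2 := (Real.isLittleO_log_id_atTop.comp_tendsto
    (tendsto_atTop_add_const_right atTop 2 tendsto_id)).bound (show (0 : ℝ) < 1 / 8 by norm_num)
  filter_upwards [h1, h2, eventually_ge_atTop 8] with x h1 h2 hx
  have hlog : 0 < Real.log x := Real.log_pos (by linarith)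
  have hlog2 := Real.log_two_gt_d9
  simp only [Function.comp_apply, id_eq, Real.norm_eq_abs] at h1 h2
  rw [abs_of_pos hlog, abs_of_nonneg (by positivity)] at h1
  rw [abs_of_nonneg (Real.log_nonneg (by linarith)), abs_of_nonneg (by linarith)] at h2
  refine le_trans ?_ (Chebyshev.pi_ge' (by linarith : 1 < x))
  rw [le_div_iff₀ hlog]
  calc x ^ (1 - η) * Real.log x ≤ x ^ (1 - η) * (1 / 8 * x ^ η) := by gcongr
    _ = 1 / 8 * x := by
        rw [mul_left_comm, ← Real.rpow_add (by linarith)]; simp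
    _ ≤ (x - 1) * Real.log 2 - Real.log (x + 2) := by nlinarith

/-- Along a geometric sequence of scales, infinitely many of the intervals between consecutive
scales contain almost as many primes as integers, up to a power `ε` of the scale. -/
lemma frequently_rpow_le_card_primesIoc {κ : ℝ} (hκ : 0 < κ) {ε : ℝ} (hε : 0 < ε) (hε1 : ε < 1) :
    ∃ᶠ k : ℕ in atTop, ((2 : ℝ) ^ (κ * k)) ^ (1 - ε) ≤
      ((primesIoc (2 ^ (κ * ((k : ℝ) - 1))) (2 ^ (κ * k))).card : ℝ) := by
  intro hev
  obtain ⟨K, hK⟩ := eventually_atTop.1 hev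
  have hpow (e : ℝ) (k : ℕ) : ((2 : ℝ) ^ (κ * k)) ^ e = ((2 : ℝ) ^ (κ * e)) ^ k := by
    rw [← Real.rpow_mul (by norm_num), ← Real.rpow_natCast, ← Real.rpow_mul (by norm_num)]
    congr 1; ring
  set C : ℝ := ((Nat.primeCounting ⌊(2 : ℝ) ^ (κ * K)⌋₊ : ℕ) : ℝ)
  have hup (j : ℕ) : (Nat.primeCounting ⌊(2 : ℝ) ^ (κ * (K + j : ℕ))⌋₊ : ℝ) ≤
      C + j * ((2 : ℝ) ^ (κ * (K + j : ℕ))) ^ (1 - ε) := by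
    induction j with
    | zero => simp [C]
    | succ j ih =>
      have h1 := primeCounting_le_add_card_primesIoc ((2 : ℝ) ^ (κ * (K + j : ℕ)))
        (y := (2 : ℝ) ^ (κ * (K + (j + 1) : ℕ))) (by positivity)
      have h2 := not_le.1 (hK (K + (j + 1)) (by omega))
      have e : κ * (((K + (j + 1) : ℕ) : ℝ) - 1) = κ * (K + j : ℕ) := by push_cast; ring
      rw [e] at h2
      have h3 : ((2 : ℝ) ^ (κ * (K + j : ℕ))) ^ (1 - ε) ≤
          ((2 : ℝ) ^ (κ * (K + (j + 1) : ℕ))) ^ (1 - ε) := by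
        refine Real.rpow_le_rpow (by positivity) ?_ (by linarith)
        refine Real.rpow_le_rpow_of_exponent_le (by norm_num) ?_
        push_cast
        nlinarith
      calc (Nat.primeCounting ⌊(2 : ℝ) ^ (κ * (K + (j + 1) : ℕ))⌋₊ : ℝ)
          ≤ Nat.primeCounting ⌊(2 : ℝ) ^ (κ * (K + j : ℕ))⌋₊ +
            (primesIoc (2 ^ (κ * (K + j : ℕ))) (2 ^ (κ * (K + (j + 1) : ℕ)))).card := by
            exact_mod_cast h1
        _ ≤ (C + j * ((2 : ℝ) ^ (κ * (K + (j + 1) : ℕ))) ^ (1 - ε)) +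
            ((2 : ℝ) ^ (κ * (K + (j + 1) : ℕ))) ^ (1 - ε) := by
            refine add_le_add (ih.trans ?_) h2.le
            gcongr
        _ = _ := by push_cast; ring
  have htop : Tendsto (fun k : ℕ ↦ (2 : ℝ) ^ (κ * k)) atTop atTop := by
    have h2 : Tendsto (fun k : ℕ ↦ κ * (k : ℝ)) atTop atTop :=
      tendsto_natCast_atTop_atTop.const_mul_atTop hκ
    refine (tendsto_rpow_atTop_of_base_gt_one (2 : ℝ) (by norm_num)).comp h2
  have hlow := htop.eventually (eventually_rpow_le_primeCounting (half_pos hε))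
  -- both terms of the upper bound are negligible
  have ht1 : Tendsto (fun k : ℕ ↦ C * ((2 : ℝ) ^ (κ * (-(1 - ε / 2)))) ^ k) atTop (𝓝 0) := by
    simpa using (tendsto_pow_atTop_nhds_zero_of_lt_one (by positivity)
      (Real.rpow_lt_one_of_one_lt_of_neg (one_lt_two (α := ℝ))
        (by nlinarith : κ * (-(1 - ε / 2)) < 0))).const_mul C
  have ht2 : Tendsto (fun k : ℕ ↦ (k : ℝ) * ((2 : ℝ) ^ (κ * (-(ε / 2)))) ^ k) atTop (𝓝 0) :=
    tendsto_self_mul_const_pow_of_lt_one (by positivity)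
      (Real.rpow_lt_one_of_one_lt_of_neg (one_lt_two (α := ℝ)) (by nlinarith))
  have ht := (ht1.add ht2).eventually (gt_mem_nhds (show (0 : ℝ) + 0 < 1 by norm_num))
  obtain ⟨k, ⟨hk1, hk2⟩, hkK⟩ := ((hlow.and ht).and (eventually_ge_atTop K)).exists
  obtain ⟨j, rfl⟩ := Nat.exists_eq_add_of_le hkK
  set x : ℝ := (2 : ℝ) ^ (κ * (K + j : ℕ)) with hx
  have hx0 : 0 < x := by positivity
  have h3 := hk1.trans (hup j)
  have h4 : x ^ (1 - ε / 2) * (C * x ^ (-(1 - ε / 2)) + (K + j : ℕ) * x ^ (-(ε / 2))) <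
      x ^ (1 - ε / 2) * 1 := by
    rw [hpow (-(1 - ε / 2)), hpow (-(ε / 2))]
    exact mul_lt_mul_of_pos_left hk2 (by positivity)
  have h5 : x ^ (1 - ε / 2) * (C * x ^ (-(1 - ε / 2)) + (K + j : ℕ) * x ^ (-(ε / 2))) =
      C + (K + j : ℕ) * x ^ (1 - ε) := by
    rw [mul_add, mul_left_comm, ← Real.rpow_add hx0, mul_left_comm, ← Real.rpow_add hx0,
      add_neg_cancel, Real.rpow_zero, mul_one]
    congr 3; ring
  rw [h5, mul_one] at h4
  have h6 : (j : ℝ) * x ^ (1 - ε) ≤ (K + j : ℕ) * x ^ (1 - ε) := by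
    gcongr; omega
  linarith

/-! ### Correlations of the slab densities -/

section Kernel
variable {ι : Type*} [Fintype ι]

/-- The correlation kernel at scale `ρ`, a product of tents. -/
noncomputable def tentKernel (ρ : ℝ) (p : (ι → ℝ) × (ι → ℝ)) : ℝ := ∏ i, tent ((p.1 i - p.2 i) / ρ)

lemma continuous_tentKernel (ρ : ℝ) : Continuous (tentKernel (ι := ι) ρ) := by
  unfold tentKernel
  refine continuous_finsetProd _ fun i _ ↦ continuous_tent.comp ?_
  fun_prop

lemma tentKernel_nonneg (ρ : ℝ) (p : (ι → ℝ) × (ι → ℝ)) : 0 ≤ tentKernel ρ p :=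
  Finset.prod_nonneg fun _ _ ↦ tent_nonneg _

lemma le_tentKernel_of_mem_nearPairs {m : ℕ} {p : (ι → ℝ) × (ι → ℝ)}
    (hp : p ∈ nearPairs (ι → ℝ) m) :
    (1 / 2) ^ Fintype.card ι ≤ tentKernel (4 * 2 ^ (-(m : ℝ))) p := by
  have hr : (0 : ℝ) < 2 ^ (-(m : ℝ)) := by positivity
  have h1 : dist p.1 p.2 < 2 * 2 ^ (-(m : ℝ)) := by
    have h2 : edist p.1 p.2 < ENNReal.ofReal (2 * 2 ^ (-(m : ℝ))) := by
      refine lt_of_lt_of_eq hp ?_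
      rw [ENNReal.ofReal_mul (by norm_num), ← ENNReal.ofReal_rpow_of_pos (by norm_num)]
      simp
    rwa [edist_dist, ENNReal.ofReal_lt_ofReal_iff (by positivity)] at h2
  rw [← Finset.card_univ, ← Finset.prod_const]
  refine Finset.prod_le_prod (fun _ _ ↦ by norm_num) fun i _ ↦ ?_
  have h2 : |p.1 i - p.2 i| ≤ 2 * 2 ^ (-(m : ℝ)) := (dist_le_pi_dist p.1 p.2 i).trans h1.le
  refine le_trans ?_ (le_max_right _ _)
  rw [abs_div, abs_of_pos (by positivity : (0 : ℝ) < 4 * 2 ^ (-(m : ℝ)))]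
  have : |p.1 i - p.2 i| / (4 * 2 ^ (-(m : ℝ))) ≤ 1 / 2 := by
    rw [div_le_iff₀ (by positivity)]; linarith
  linarith

/-- Correlation integrals of product functions factor over the coordinates. -/
lemma setIntegral_tentKernel_mul_prod (ρ : ℝ) {u v : ι → ℝ → ℝ} (hu : ∀ i, Continuous (u i))
    (hv : ∀ i, Continuous (v i)) :
    ∫ p in (Set.pi univ fun _ : ι ↦ Icc (0 : ℝ) 1) ×ˢ (Set.pi univ fun _ : ι ↦ Icc (0 : ℝ) 1),
      tentKernel ρ p * ((∏ i, u i (p.1 i)) * ∏ i, v i (p.2 i)) =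
    ∏ i, ∫ z in Icc (0 : ℝ) 1 ×ˢ Icc (0 : ℝ) 1,
      tent ((z.1 - z.2) / ρ) * (u i z.1 * v i z.2) := by
  have hK : IsCompact (Set.pi univ fun _ : ι ↦ Icc (0 : ℝ) 1) :=
    isCompact_univ_pi fun _ ↦ isCompact_Icc
  have ht := continuous_tent
  have hc1 (i : ι) : ∫ z in Icc (0 : ℝ) 1 ×ˢ Icc (0 : ℝ) 1,
      tent ((z.1 - z.2) / ρ) * (u i z.1 * v i z.2) =
      ∫ x in Icc (0 : ℝ) 1, ∫ y in Icc (0 : ℝ) 1, tent ((x - y) / ρ) * (u i x * v i y) := by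
    rw [Measure.volume_eq_prod, setIntegral_prod]
    refine ContinuousOn.integrableOn_compact (isCompact_Icc.prod isCompact_Icc)
      (Continuous.continuousOn ?_)
    have := hu i; have := hv i
    fun_prop
  rw [Measure.volume_eq_prod, setIntegral_prod]
  · simp_rw [hc1]
    have hres : (volume : Measure (ι → ℝ)).restrict (Set.pi univ fun _ : ι ↦ Icc (0 : ℝ) 1) =
        Measure.pi fun _ ↦ volume.restrict (Icc (0 : ℝ) 1) := by
      rw [volume_pi, Measure.restrict_pi_pi]
    rw [hres, ← integral_fintype_prod_eq_prod]
    congr 1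
    ext x
    rw [← integral_fintype_prod_eq_prod]
    congr 1
    ext y
    simp only [tentKernel]
    rw [← Finset.prod_mul_distrib, ← Finset.prod_mul_distrib]
  · refine ContinuousOn.integrableOn_compact (hK.prod hK) (Continuous.continuousOn ?_)
    refine (continuous_tentKernel ρ).mul (Continuous.mul ?_ ?_)
    · exact continuous_finsetProd _ fun i _ ↦ (hu i).comp (by fun_prop)
    · exact continuous_finsetProd _ fun i _ ↦ (hv i).comp (by fun_prop)

end Kernel

lemma IsAveraging.mono {E : Type*} [NormedAddCommGroup E] [MeasurableSpace E] {δ δ' : ℝ}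
    {H : E → ℝ} (h : IsAveraging δ H) (hδ : δ ≤ δ') : IsAveraging δ' H := by
  obtain ⟨ρ, h1, h2, h3⟩ := h.average
  exact ⟨h.continuous, h.nonneg, h.bounded, ρ, h1, h2.mono fun τ hτ ↦ hτ.trans hδ, h3⟩

/-- The factors of the density attached to the denominator `q`: a `fareyBump` with period `t⁻¹` in
the first coordinate, and combs of spacing `(q * D)⁻¹` in the others. -/
noncomputable def coordDensity {m : ℕ} (c t D w : ℝ) (q : ℕ) : Fin (m + 1) → ℝ → ℝ :=
  Fin.cons (fun x ↦ fareyBump c q (t * x)) fun _ ↦ combBump (q * D) w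

/-- The density attached to the denominator `q`. -/
noncomputable def slabDensity {m : ℕ} (c t D w : ℝ) (q : ℕ) (x : Fin (m + 1) → ℝ) : ℝ :=
  ∏ i, coordDensity c t D w q i (x i)

lemma isAveraging_combBump {Λ w : ℝ} (hΛ : 0 < Λ) (hw : 0 < w) (hΛw : Λ * w ≤ 1 / 2) :
    IsAveraging Λ⁻¹ (combBump Λ w) := by
  have hW : 0 < Λ * w := mul_pos hΛ hw
  refine isAveraging_comp_mul (u := fun x ↦ (Λ * w)⁻¹ * bump (Λ * w) x)
    ((continuous_bump _).const_mul _) (fun x ↦ mul_nonneg (inv_pos.2 hW).le (bump_nonneg _ _))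
    (fun x ↦ by dsimp only; rw [bump_periodic]) ?_ hΛ
  rw [intervalIntegral.integral_const_mul, integral_bump hW hΛw, inv_mul_cancel₀ hW.ne']

lemma continuous_coordDensity {m : ℕ} (c t D w : ℝ) (q : ℕ) (i : Fin (m + 1)) :
    Continuous (coordDensity c t D w q i) := by
  refine Fin.cases ?_ (fun j ↦ ?_) i
  · exact (continuous_fareyBump c q).comp (continuous_const_mul t)
  · exact continuous_combBump _ _

lemma isAveraging_slabDensity {m : ℕ} {c t D w δ : ℝ} {q : ℕ} (hc : 0 < c) (hc2 : c ≤ 1 / 2)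
    (ht : 0 < t) (hD : 0 < D) (hw : 0 < w) (hq : 2 ≤ q) (hqD : q * D * w ≤ 1 / 2)
    (htδ : t⁻¹ ≤ δ) (hDδ : D⁻¹ ≤ δ) : IsAveraging δ (slabDensity (m := m) c t D w q) := by
  have hq1 : (1 : ℝ) ≤ q := by exact_mod_cast (by omega : 1 ≤ q)
  refine IsAveraging.pi ((inv_pos.2 ht).le.trans htδ) fun i ↦ ?_
  refine Fin.cases ?_ (fun j ↦ ?_) i
  · exact (isAveraging_comp_mul (continuous_fareyBump c q) (fareyBump_nonneg hc hq)
      (fareyBump_periodic c q) (integral_fareyBump hc hc2 hq) ht).mono htδ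
  · refine (isAveraging_combBump (by positivity) hw hqD).mono (le_trans ?_ hDδ)
    exact inv_anti₀ hD (le_mul_of_one_le_left hD.le hq1)

lemma le_four_mul_rpow {a ρ : ℝ} (ha : 0 < a) (ha1 : a ≤ 1) (hρ : 0 < ρ) (hρ4 : ρ ≤ 4) :
    ρ ≤ 4 * ρ ^ a := by
  have h1 : ρ ^ (1 - a) ≤ 4 := by
    calc ρ ^ (1 - a) ≤ 4 ^ (1 - a) := Real.rpow_le_rpow hρ.le hρ4 (by linarith)
      _ ≤ 4 ^ (1 : ℝ) := Real.rpow_le_rpow_of_exponent_le (by norm_num) (by linarith)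
      _ = 4 := by norm_num
  calc ρ = ρ ^ (1 - a) * ρ ^ a := by rw [← Real.rpow_add hρ]; simp
    _ ≤ 4 * ρ ^ a := by gcongr

/-- The elementary inequality behind the correlation bounds: for `w` comparable to `R⁻¹`, a comb
whose correlations are limited by `R ^ (-a)` has correlations `O(ρ ^ a)` at all scales. -/
lemma min_div_mul_le_rpow {a c R w ρ B : ℝ} (ha : 0 < a) (ha1 : a ≤ 1) (hc : 0 < c) (hc1 : c ≤ 1)
    (hR : 0 < R) (hw : w = c / R) (hρ : 0 < ρ) (hρ4 : ρ ≤ 4) (hB : 1 ≤ B) :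
    min w ρ / w * (w + ρ + 4 * (R ^ (-a) * B)) ≤ 12 / c * B * ρ ^ a := by
  have hw0 : 0 < w := by rw [hw]; positivity
  have hRw : R ^ (-a) ≤ w ^ a / c := by
    have e : R = c / w := by rw [hw]; field_simp
    have h1 : c ≤ c ^ a := by
      simpa using Real.rpow_le_rpow_of_exponent_ge hc hc1 ha1
    rw [e, Real.rpow_neg (by positivity), Real.div_rpow hc.le hw0.le, inv_div]
    gcongr
  have hρa : 0 < ρ ^ a := by positivity
  have hρle : ρ ≤ 4 * ρ ^ a := le_four_mul_rpow ha ha1 hρ hρ4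
  -- in both regimes the bound `2 * ρ + (4 / c) * B * ρ ^ a` holds
  have key : min w ρ / w * (w + ρ + 4 * (R ^ (-a) * B)) ≤ 2 * ρ + 4 / c * B * ρ ^ a := by
    rcases le_total w ρ with h | h
    · rw [min_eq_left h, div_self hw0.ne', one_mul]
      have h2 : w ^ a ≤ ρ ^ a := Real.rpow_le_rpow hw0.le h ha.le
      have h3 : R ^ (-a) * B ≤ ρ ^ a / c * B := by
        refine mul_le_mul_of_nonneg_right (hRw.trans ?_) (by linarith)
        gcongr
      calc w + ρ + 4 * (R ^ (-a) * B) ≤ ρ + ρ + 4 * (ρ ^ a / c * B) := by gcongr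
        _ = _ := by ring
    · rw [min_eq_right h]
      have h2 : ρ / w * w ^ a ≤ ρ ^ a := by
        have h3 : (ρ / w) ≤ (ρ / w) ^ a := by
          simpa using Real.rpow_le_rpow_of_exponent_ge (by positivity) ((div_le_one hw0).2 h) ha1
        calc ρ / w * w ^ a ≤ (ρ / w) ^ a * w ^ a := by gcongr
          _ = ρ ^ a := by rw [← Real.mul_rpow (by positivity) hw0.le]; field_simp
      calc ρ / w * (w + ρ + 4 * (R ^ (-a) * B))
          ≤ ρ / w * (w + w + 4 * (w ^ a / c * B)) := by gcongr
        _ = 2 * (ρ / w * w) + 4 / c * B * (ρ / w * w ^ a) := by ring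
        _ ≤ 2 * ρ + 4 / c * B * ρ ^ a := by
          rw [div_mul_cancel₀ _ hw0.ne']; gcongr
  have h8 : 8 * ρ ^ a ≤ 8 / c * B * ρ ^ a := by
    refine mul_le_mul_of_nonneg_right ?_ hρa.le
    have : 8 ≤ 8 / c := by rw [le_div_iff₀ hc]; linarith
    nlinarith
  calc _ ≤ 2 * ρ + 4 / c * B * ρ ^ a := key
    _ ≤ 8 / c * B * ρ ^ a + 4 / c * B * ρ ^ a := by linarith
    _ = _ := by ring

section Correlation
variable {m : ℕ} {a c t R D Q w ρ ε : ℝ}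

/-- The correlation integral of the densities attached to `q` and `q'` is bounded by that of the
first coordinate, which is trivial, times the `m`-th power of that of the combs. -/
lemma setIntegral_slabDensity_le (hc : 0 < c) (hD : 0 < D) (hw : 0 < w) (hρ : 0 < ρ)
    {q q' : ℕ} (hq : 2 ≤ q) (hq' : 2 ≤ q') {B : ℝ}
    (hB : ∫ z in Icc (0 : ℝ) 1 ×ˢ Icc (0 : ℝ) 1,
      tent ((z.1 - z.2) / ρ) * (combBump (q * D) w z.1 * combBump (q' * D) w z.2) ≤ B) :
    ∫ p in (Set.pi univ fun _ : Fin (m + 1) ↦ Icc (0 : ℝ) 1) ×ˢ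
        (Set.pi univ fun _ : Fin (m + 1) ↦ Icc (0 : ℝ) 1),
      tentKernel ρ p * (slabDensity c t D w q p.1 * slabDensity c t D w q' p.2) ≤
      8 / c ^ 2 * ρ * B ^ m := by
  unfold slabDensity
  have hq0 : (0 : ℝ) < q := by exact_mod_cast (by omega : 0 < q)
  have hq0' : (0 : ℝ) < q' := by exact_mod_cast (by omega : 0 < q')
  rw [setIntegral_tentKernel_mul_prod ρ (continuous_coordDensity c t D w q)
    (continuous_coordDensity c t D w q'), Fin.prod_univ_succ]
  simp only [coordDensity, Fin.cons_zero, Fin.cons_succ, Finset.prod_const, Finset.card_univ,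
    Fintype.card_fin]
  have hB0 : 0 ≤ ∫ z in Icc (0 : ℝ) 1 ×ˢ Icc (0 : ℝ) 1,
      tent ((z.1 - z.2) / ρ) * (combBump (q * D) w z.1 * combBump (q' * D) w z.2) :=
    integral_nonneg fun z ↦ mul_nonneg (tent_nonneg _)
      (mul_nonneg (combBump_nonneg (by positivity) hw _) (combBump_nonneg (by positivity) hw _))
  refine mul_le_mul ?_ (pow_le_pow_left₀ hB0 hB m) (pow_nonneg hB0 m) (by positivity)
  refine (integral_tent_mul_le (M := 2 / c)
    ((continuous_fareyBump c q).comp (continuous_const_mul t))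
    ((continuous_fareyBump c q').comp (continuous_const_mul t))
    (fun x ↦ fareyBump_nonneg hc hq _) (fun x ↦ fareyBump_nonneg hc hq' _)
    (fun x ↦ fareyBump_le hc hq _) (fun x ↦ fareyBump_le hc hq' _) hρ).trans_eq ?_
  field_simp
  ring

/-- Averaging over many primes `q ∈ (Q / 2, Q]` gives correlations `O(ρ ^ (1 + m * a - ε))`.
Distinct primes are nearly independent, and the contribution of equal ones is compensated by the
number of primes. -/
theorem setIntegral_average_slabDensity_le (ha : 0 < a) (ha1 : a ≤ 1) (hc : 0 < c)
    (hc1 : c ≤ 1) (hm : 1 ≤ m) (hR : 0 < R) (hD : 1 ≤ D) (hQ : 1 ≤ Q) (hw : w = c / R)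
    (hQD : Q * D ≤ R) (h1 : 1 / (Q ^ 2 * D) ≤ R ^ (-a))
    (h2 : 1 / (Q * D) ≤ R ^ (-a) * Q ^ ((m : ℝ)⁻¹)) (hρ : 0 < ρ) (hρ4 : ρ ≤ 4)
    (hε : 0 ≤ ε) (hε1 : ε ≤ 1) {P : Finset ℕ} (hP : ∀ q ∈ P, q.Prime ∧ Q / 2 ≤ q)
    (hPc : Q ^ (1 - ε) ≤ P.card) :
    ∫ p in (Set.pi univ fun _ : Fin (m + 1) ↦ Icc (0 : ℝ) 1) ×ˢ
        (Set.pi univ fun _ : Fin (m + 1) ↦ Icc (0 : ℝ) 1),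
      tentKernel ρ p * (((P.card : ℝ)⁻¹ * ∑ q ∈ P, slabDensity c t D w q p.1) *
        ((P.card : ℝ)⁻¹ * ∑ q ∈ P, slabDensity c t D w q p.2)) ≤
      64 / c ^ 2 * (768 / c) ^ m * ρ ^ (1 + m * a - ε) := by
  have hQ0 : 0 < Q := by linarith
  have hD0 : 0 < D := by linarith
  have hw0 : 0 < w := by rw [hw]; positivity
  have hcard : (0 : ℝ) < P.card := lt_of_lt_of_le (by positivity) hPc
  have hm0 : (m : ℝ) ≠ 0 := by exact_mod_cast (by omega : m ≠ 0)
  set A : ℝ := 32 / c ^ 2 * (768 / c) ^ m * ρ ^ (1 + m * a - ε) with hA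
  have hA0 : 0 ≤ A := by positivity
  set J : ℕ → ℕ → ℝ := fun q q' ↦
    ∫ p in (Set.pi univ fun _ : Fin (m + 1) ↦ Icc (0 : ℝ) 1) ×ˢ
        (Set.pi univ fun _ : Fin (m + 1) ↦ Icc (0 : ℝ) 1),
      tentKernel ρ p * (slabDensity c t D w q p.1 * slabDensity c t D w q' p.2) with hJ
  have hexp : ρ * (ρ ^ a) ^ m ≤ 4 * ρ ^ (1 + m * a - ε) := by
    have e : ρ * (ρ ^ a) ^ m = ρ ^ ε * ρ ^ (1 + m * a - ε) := by
      rw [← Real.rpow_natCast, ← Real.rpow_mul hρ.le, ← Real.rpow_add hρ,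
        ← Real.rpow_one_add' hρ.le (by positivity)]
      congr 1; ring
    rw [e]
    refine mul_le_mul_of_nonneg_right ?_ (by positivity)
    calc ρ ^ ε ≤ 4 ^ ε := Real.rpow_le_rpow hρ.le hρ4 hε
      _ ≤ 4 ^ (1 : ℝ) := Real.rpow_le_rpow_of_exponent_le (by norm_num) hε1
      _ = 4 := by norm_num
  have hbound {q q' : ℕ} (hq : q ∈ P) (hq' : q' ∈ P) {B : ℝ} (hB0 : 0 ≤ B)
      (hB : ∫ z in Icc (0 : ℝ) 1 ×ˢ Icc (0 : ℝ) 1,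
      tent ((z.1 - z.2) / ρ) * (combBump (q * D) w z.1 * combBump (q' * D) w z.2) ≤ B)
      (hBρ : B ≤ 768 / c * ρ ^ a) : J q q' ≤ A := by
    refine (setIntegral_slabDensity_le hc hD0 hw0 hρ (hP q hq).1.two_le
      (hP q' hq').1.two_le hB).trans ?_
    calc 8 / c ^ 2 * ρ * B ^ m ≤ 8 / c ^ 2 * ρ * (768 / c * ρ ^ a) ^ m := by gcongr
      _ = 8 / c ^ 2 * (768 / c) ^ m * (ρ * (ρ ^ a) ^ m) := by rw [mul_pow]; ring
      _ ≤ 8 / c ^ 2 * (768 / c) ^ m * (4 * ρ ^ (1 + m * a - ε)) := by gcongr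
      _ = A := by rw [hA]; ring
  -- distinct primes
  have hoff (q q' : ℕ) (hq : q ∈ P) (hq' : q' ∈ P) (hne : q ≠ q') : J q q' ≤ A := by
    have hqQ := (hP q hq).2
    have hqQ' := (hP q' hq').2
    have hle := integral_combBump_coprime_le (hP q hq).1.pos (hP q' hq').1.pos
      ((Nat.coprime_primes (hP q hq).1 (hP q' hq').1).2 hne) hD hw0 hρ
    refine hbound hq hq' (le_trans (integral_nonneg fun z ↦ mul_nonneg (tent_nonneg _)
      (mul_nonneg (combBump_nonneg ?_ hw0 _) (combBump_nonneg ?_ hw0 _))) hle) hle ?_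
    · have := (hP q hq).1.pos; positivity
    · have := (hP q' hq').1.pos; positivity
    · have h3 : 1 / ((q : ℝ) * q' * D) ≤ 4 * (R ^ (-a) * 1) := by
        rw [mul_one]
        calc 1 / ((q : ℝ) * q' * D) ≤ 1 / (Q / 2 * (Q / 2) * D) := by gcongr
          _ = 4 * (1 / (Q ^ 2 * D)) := by field_simp; ring
          _ ≤ _ := by gcongr
      have h4 := min_div_mul_le_rpow ha ha1 hc hc1 hR hw hρ hρ4 le_rfl
      have h5 : 0 ≤ min w ρ / w := by positivity
      calc 48 * (min w ρ / w) * (w + ρ + 1 / (q * q' * D))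
          ≤ 48 * (min w ρ / w) * (w + ρ + 4 * (R ^ (-a) * 1)) := by gcongr
        _ = 48 * (min w ρ / w * (w + ρ + 4 * (R ^ (-a) * 1))) := by ring
        _ ≤ 48 * (12 / c * 1 * ρ ^ a) := by gcongr
        _ = 576 / c * ρ ^ a := by ring
        _ ≤ _ := by gcongr; norm_num
  -- equal primes
  have hdiag (q : ℕ) (hq : q ∈ P) : J q q ≤ P.card * A := by
    have hqQ := (hP q hq).2
    have hq1 : (1 : ℝ) ≤ q := by exact_mod_cast (hP q hq).1.one_le
    have hle := integral_combBump_self_le (Λ := q * D) (by nlinarith) hw0 hρ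
    have h3 : 1 / ((q : ℝ) * D) ≤ 2 / (Q * D) := by
      calc 1 / ((q : ℝ) * D) ≤ 1 / (Q / 2 * D) := by gcongr
        _ = 2 / (Q * D) := by field_simp
    have h5 : 0 ≤ min w ρ / w := by positivity
    have hnn : 0 ≤ 48 * (min w ρ / w) * (w + ρ + 1 / (q * D)) := by positivity
    rcases le_or_gt (1 / (Q * D)) ρ with hρQ | hρQ
    · have hcard1 : (1 : ℝ) ≤ P.card :=
        le_trans (Real.one_le_rpow hQ (by linarith)) hPc
      refine (hbound hq hq hnn hle ?_).trans (le_mul_of_one_le_left hA0 hcard1)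
      have hwQ : w ≤ 1 / (Q * D) := by
        rw [hw, div_le_div_iff₀ hR (by positivity)]
        nlinarith
      have hwρ : w ≤ ρ := hwQ.trans hρQ
      rw [min_eq_left hwρ, div_self hw0.ne', mul_one]
      have h6 : ρ ≤ 4 * ρ ^ a := le_four_mul_rpow ha ha1 hρ hρ4
      have h7 : 2 / (Q * D) ≤ 2 * ρ := by
        calc 2 / (Q * D) = 2 * (1 / (Q * D)) := by ring
          _ ≤ _ := by gcongr
      have h8 : (768 : ℝ) ≤ 768 / c := by rw [le_div_iff₀ hc]; linarith
      calc 48 * (w + ρ + 1 / (q * D)) ≤ 192 * ρ := by linarith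
        _ ≤ 768 * ρ ^ a := by linarith
        _ ≤ _ := by gcongr
    · have hρ1 : Q < ρ⁻¹ := by
        rw [lt_inv_comm₀ hQ0 hρ]
        refine hρQ.trans_le ?_
        rw [one_div]
        exact inv_anti₀ hQ0 (le_mul_of_one_le_right hQ0.le hD)
      have h4 := min_div_mul_le_rpow (B := Q ^ ((m : ℝ)⁻¹)) ha ha1 hc hc1 hR hw hρ hρ4
        (Real.one_le_rpow hQ (by positivity))
      have h6 : 48 * (min w ρ / w) * (w + ρ + 1 / (q * D)) ≤
          768 / c * Q ^ ((m : ℝ)⁻¹) * ρ ^ a := by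
        calc 48 * (min w ρ / w) * (w + ρ + 1 / (q * D))
            ≤ 48 * (min w ρ / w) * (w + ρ + 4 * (R ^ (-a) * Q ^ ((m : ℝ)⁻¹))) := by
              gcongr
              have : 2 / (Q * D) = 2 * (1 / (Q * D)) := by ring
              have : 0 < 1 / (Q * D) := by positivity
              linarith
          _ = 48 * (min w ρ / w * (w + ρ + 4 * (R ^ (-a) * Q ^ ((m : ℝ)⁻¹)))) := by ring
          _ ≤ 48 * (12 / c * Q ^ ((m : ℝ)⁻¹) * ρ ^ a) := by gcongr
          _ = 576 / c * Q ^ ((m : ℝ)⁻¹) * ρ ^ a := by ring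
          _ ≤ _ := by gcongr; norm_num
      refine (setIntegral_slabDensity_le hc hD0 hw0 hρ (hP q hq).1.two_le (hP q hq).1.two_le
        (hle.trans h6)).trans ?_
      have hQm : (Q ^ ((m : ℝ)⁻¹)) ^ m = Q := by
        rw [← Real.rpow_natCast, ← Real.rpow_mul hQ0.le, inv_mul_cancel₀ hm0, Real.rpow_one]
      -- the loss `Q ^ ε` is absorbed because `ρ < 1 / Q`
      have hQε : Q ≤ P.card * ρ ^ (-ε) := by
        calc Q = Q ^ (1 - ε) * Q ^ ε := by rw [← Real.rpow_add hQ0]; simp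
          _ ≤ P.card * (ρ⁻¹) ^ ε := by gcongr
          _ = P.card * ρ ^ (-ε) := by rw [Real.inv_rpow hρ.le, Real.rpow_neg hρ.le]
      calc 8 / c ^ 2 * ρ * (768 / c * Q ^ ((m : ℝ)⁻¹) * ρ ^ a) ^ m
          = 8 / c ^ 2 * (768 / c) ^ m * (ρ * (ρ ^ a) ^ m) * Q := by
            rw [mul_pow, mul_pow, hQm]; ring
        _ ≤ 8 / c ^ 2 * (768 / c) ^ m * (ρ * (ρ ^ a) ^ m) * (P.card * ρ ^ (-ε)) := by gcongr
        _ = P.card * (8 / c ^ 2 * (768 / c) ^ m * ρ ^ (1 + m * a - ε)) := by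
            have e : ρ ^ (1 + m * a - ε) = ρ * (ρ ^ a) ^ m * ρ ^ (-ε) := by
              rw [← Real.rpow_natCast (ρ ^ a), ← Real.rpow_mul hρ.le,
                ← Real.rpow_one_add' hρ.le (by positivity), ← Real.rpow_add hρ]
              congr 1; ring
            rw [e]; ring
        _ ≤ P.card * A := by
            rw [hA]
            gcongr
            norm_num
  have hint (q q' : ℕ) : IntegrableOn (fun p : (Fin (m + 1) → ℝ) × (Fin (m + 1) → ℝ) ↦
      tentKernel ρ p * (slabDensity c t D w q p.1 * slabDensity c t D w q' p.2))
      ((Set.pi univ fun _ : Fin (m + 1) ↦ Icc (0 : ℝ) 1) ×ˢ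
        (Set.pi univ fun _ : Fin (m + 1) ↦ Icc (0 : ℝ) 1)) := by
    have hK : IsCompact (Set.pi univ fun _ : Fin (m + 1) ↦ Icc (0 : ℝ) 1) :=
      isCompact_univ_pi fun _ ↦ isCompact_Icc
    refine ContinuousOn.integrableOn_compact (hK.prod hK) (Continuous.continuousOn ?_)
    unfold slabDensity
    refine (continuous_tentKernel ρ).mul (Continuous.mul ?_ ?_)
    · exact continuous_finsetProd _ fun i _ ↦
        (continuous_coordDensity _ _ _ _ q i).comp (by fun_prop)
    · exact continuous_finsetProd _ fun i _ ↦
        (continuous_coordDensity _ _ _ _ q' i).comp (by fun_prop)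
  have hsum : ∫ p in (Set.pi univ fun _ : Fin (m + 1) ↦ Icc (0 : ℝ) 1) ×ˢ
        (Set.pi univ fun _ : Fin (m + 1) ↦ Icc (0 : ℝ) 1),
      tentKernel ρ p * (((P.card : ℝ)⁻¹ * ∑ q ∈ P, slabDensity c t D w q p.1) *
        ((P.card : ℝ)⁻¹ * ∑ q ∈ P, slabDensity c t D w q p.2)) =
      ((P.card : ℝ)⁻¹ * (P.card : ℝ)⁻¹) * ∑ q ∈ P, ∑ q' ∈ P, J q q' := by
    have e (p : (Fin (m + 1) → ℝ) × (Fin (m + 1) → ℝ)) :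
        tentKernel ρ p * (((P.card : ℝ)⁻¹ * ∑ q ∈ P, slabDensity c t D w q p.1) *
        ((P.card : ℝ)⁻¹ * ∑ q ∈ P, slabDensity c t D w q p.2)) =
        ((P.card : ℝ)⁻¹ * (P.card : ℝ)⁻¹) * ∑ q ∈ P, ∑ q' ∈ P,
          tentKernel ρ p * (slabDensity c t D w q p.1 * slabDensity c t D w q' p.2) := by
      rw [mul_mul_mul_comm, Finset.sum_mul_sum, mul_left_comm, Finset.mul_sum]
      congr 1
      exact Finset.sum_congr rfl fun q _ ↦ Finset.mul_sum _ _ _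
    simp_rw [e]
    rw [integral_const_mul, integral_finsetSum _ fun q _ ↦ integrable_finsetSum _ fun q' _ ↦
      hint q q']
    congr 1
    exact Finset.sum_congr rfl fun q _ ↦ integral_finsetSum _ fun q' _ ↦ hint q q'
  rw [hsum]
  have hrow (q : ℕ) (hq : q ∈ P) : ∑ q' ∈ P, J q q' ≤ P.card * A + P.card * A := by
    rw [← Finset.add_sum_erase P _ hq]
    refine add_le_add (hdiag q hq) ?_
    calc ∑ q' ∈ P.erase q, J q q' ≤ ∑ q' ∈ P.erase q, A :=
          Finset.sum_le_sum fun q' hq' ↦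
            hoff q q' hq (Finset.mem_of_mem_erase hq') (Finset.ne_of_mem_erase hq').symm
      _ = (P.erase q).card * A := by rw [Finset.sum_const, nsmul_eq_mul]
      _ ≤ P.card * A := by
          gcongr
          exact Finset.erase_subset q P
  calc ((P.card : ℝ)⁻¹ * (P.card : ℝ)⁻¹) * ∑ q ∈ P, ∑ q' ∈ P, J q q'
      ≤ ((P.card : ℝ)⁻¹ * (P.card : ℝ)⁻¹) * ∑ q ∈ P, (P.card * A + P.card * A) := by
        gcongr with q hq; exact hrow q hq
    _ = 2 * A := by
        rw [Finset.sum_const, nsmul_eq_mul]; field_simp; ring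
    _ = _ := by rw [hA]; ring

end Correlation

/-! ### Slabs and scales -/

/-- A closed set carrying the densities `slabDensity` for `q ∈ P`. -/
def slabSupport {m : ℕ} (c t D w : ℝ) (P : Finset ℕ) : Set (Fin (m + 1) → ℝ) :=
  ⋃ q ∈ P, {x | (distInt (q * (t * x 0)) ≤ c ∧ 1 / 2 ≤ q * distInt (t * x 0)) ∧
    ∀ j : Fin m, distInt (q * D * x j.succ) ≤ q * D * w}

lemma isClosed_slabSupport {m : ℕ} (c t D w : ℝ) (P : Finset ℕ) :
    IsClosed (slabSupport (m := m) c t D w P) := by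
  have h := continuous_distInt
  refine isClosed_biUnion_finset fun q _ ↦ ?_
  refine IsClosed.and (IsClosed.and ?_ ?_) ?_
  · exact isClosed_le (by fun_prop) continuous_const
  · exact isClosed_le continuous_const (by fun_prop)
  · simp only [ofPred_forall]
    exact isClosed_iInter fun j ↦ isClosed_le (by fun_prop) continuous_const

lemma mem_slabSupport_of_sum_ne_zero {m : ℕ} {c t D w : ℝ} (hc : 0 < c) (hD : 0 < D) (hw : 0 < w)
    {P : Finset ℕ} (hP : ∀ q ∈ P, 0 < q) {x : Fin (m + 1) → ℝ}
    (h : ∑ q ∈ P, slabDensity c t D w q x ≠ 0) : x ∈ slabSupport c t D w P := by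
  obtain ⟨q, hq, hqx⟩ := Finset.exists_ne_zero_of_sum_ne_zero h
  have hq0 : (0 : ℝ) < q := by exact_mod_cast hP q hq
  rw [slabDensity, Finset.prod_ne_zero_iff] at hqx
  refine Set.mem_iUnion₂.2 ⟨q, hq, ?_, fun j ↦ ?_⟩
  · have := hqx 0 (Finset.mem_univ _)
    simp only [coordDensity, Fin.cons_zero] at this
    exact le_of_fareyBump_ne_zero hc (hP q hq) this
  · have := hqx j.succ (Finset.mem_univ _)
    simp only [coordDensity, Fin.cons_succ, combBump] at this
    by_contra hlt
    exact this (by rw [bump_eq_zero (by positivity) (not_le.1 hlt).le, mul_zero])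

lemma abs_sub_round_div_le {L x v : ℝ} (hL : 0 < L) (h : distInt (L * x) ≤ v) :
    |x - round (L * x) / L| ≤ v / L := by
  rw [distInt_eq] at h
  have e : x - round (L * x) / L = (L * x - round (L * x)) / L := by field_simp
  rw [e, abs_div, abs_of_pos hL]
  gcongr

/-- Every point of `slabSupport` lies in a slab of generation `k`: rounding gives the numerators,
the first of which is prime to `q` because its distance to `q ℤ` is at least `1 / 2 - c > 0`. -/
lemma slabSupport_subset_levelSet {m : ℕ} {a b c c₁ : ℝ} {k : ℕ} (hc₁ : 0 < c₁)
    (hc₁' : c₁ < 1 / 2) (hc₁c : 8 * c₁ ≤ c) (hD : 0 < scaleD (m + 1) a b k)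
    (hQ : 0 < scaleQ (m + 1) a b k)
    (hQD : scaleQ (m + 1) a b k * scaleD (m + 1) a b k ^ 2 = scaleR k ^ (3 / 2 : ℝ))
    {P : Finset ℕ} (hP : ∀ q ∈ P, q.Prime ∧ 2 < q ∧ scaleQ (m + 1) a b k / 2 ≤ q ∧
      (q : ℝ) ≤ scaleQ (m + 1) a b k) {x : Fin (m + 1) → ℝ}
    (hx : x ∈ slabSupport c₁ (scaleD (m + 1) a b k ^ 2 / (2 * scaleR k)) (scaleD (m + 1) a b k)
      (c₁ / scaleR k) P) :
    WithLp.toLp 2 x ∈ levelSet (m + 1) a b c k := by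
  set D := scaleD (m + 1) a b k
  set Q := scaleQ (m + 1) a b k
  set R := scaleR k with hRdef
  have hR : 0 < R := by rw [hRdef, scaleR]; positivity
  set t := D ^ 2 / (2 * R) with ht
  have ht0 : 0 < t := by positivity
  obtain ⟨q, hqP, ⟨h1, h2⟩, h3⟩ := Set.mem_iUnion₂.1 hx
  obtain ⟨hqp, hq2, hqQ, hqQ'⟩ := hP q hqP
  have hq0 : (0 : ℝ) < q := by exact_mod_cast hqp.pos
  rw [levelSet]
  set p : Fin (m + 1) → ℤ :=
    Fin.cons (round ((q : ℝ) * t * x 0)) fun j ↦ round ((q : ℝ) * D * x j.succ) with hp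
  refine Set.mem_iUnion₂.2 ⟨slab (m + 1) c k (slabCenter (m + 1) a b k p q),
    ⟨p, q, ?_, ?_, ?_, rfl⟩,
    fun i ↦ ?_⟩
  · exact_mod_cast hqp.one_le
  · exact_mod_cast hqQ'
  · constructor
    · intro i hi
      have hi0 : i = 0 := Fin.ext hi
      subst hi0
      refine ((Nat.prime_iff_prime_int.1 hqp).irreducible.coprime_iff_not_dvd.2 ?_).symm
      rintro ⟨r, hr⟩
      simp only [hp, Fin.cons_zero] at hr
      have h4 : (q : ℝ) * distInt (t * x 0) ≤ c₁ := by
        calc (q : ℝ) * distInt (t * x 0) ≤ q * |t * x 0 - r| := by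
              gcongr; exact distInt_le _ r
          _ = |(q : ℝ) * (t * x 0) - round ((q : ℝ) * t * x 0)| := by
              rw [hr]; push_cast
              rw [← mul_sub, abs_mul, abs_of_pos hq0]
          _ = distInt (q * (t * x 0)) := by rw [distInt_eq, mul_assoc]
          _ ≤ c₁ := h1
      linarith
    · have hodd : q % 2 = 1 := by
        rcases hqp.eq_two_or_odd with h | h
        · omega
        · exact h
      refine fun j _ ↦ ⟨fun h ↦ ?_, fun h ↦ ?_⟩ <;>
      · exfalso
        unfold Int.ModEq at h
        omega
  · refine Fin.cases ?_ (fun j ↦ ?_) i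
    · have h4 := abs_sub_round_div_le (L := q * t) (v := c₁) (x := x 0) (by positivity)
        (by rw [mul_assoc]; exact h1)
      simp only [slabCenter, PiLp.toLp_apply, Fin.val_zero, if_true]
      have e : 2 * (p 0 : ℝ) * R / (((q : ℤ) : ℝ) * D ^ 2) =
          round ((q : ℝ) * t * x 0) / (q * t) := by
        simp only [hp, Fin.cons_zero]
        rw [ht]; push_cast; field_simp
      rw [e]
      refine h4.trans ?_
      have hRp : R ^ (-(1 / 2) : ℝ) = R / R ^ (3 / 2 : ℝ) := by
        rw [eq_div_iff (by positivity), ← Real.rpow_add hR]; norm_num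
      rw [hRp, ← hQD, ht]
      calc c₁ / (q * (D ^ 2 / (2 * R))) ≤ c₁ / (Q / 2 * (D ^ 2 / (2 * R))) := by gcongr
        _ = (8 * c₁) * (R / (Q * D ^ 2)) / 2 := by field_simp; ring
        _ ≤ c * (R / (Q * D ^ 2)) / 2 := by gcongr
    · have h4 := abs_sub_round_div_le (L := q * D) (x := x j.succ) (by positivity) (h3 j)
      simp only [slabCenter, PiLp.toLp_apply, Fin.val_succ, Nat.add_eq_zero_iff, one_ne_zero,
        and_false, if_false]
      have e : (p j.succ : ℝ) / (D * ((q : ℤ) : ℝ)) =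
          round ((q : ℝ) * D * x j.succ) / (q * D) := by
        simp only [hp, Fin.cons_succ]
        rw [mul_comm D]; push_cast; rfl
      rw [e]
      refine h4.trans ?_
      have e2 : (q : ℝ) * D * (c₁ / R) / (q * D) = c₁ * R⁻¹ := by field_simp
      rw [e2, mul_div_assoc, mul_comm c]
      calc c₁ * R⁻¹ ≤ (c / 2) * R⁻¹ := by gcongr; linarith
        _ = _ := by ring

section Scales

lemma scaleR_pos (k : ℕ) : 0 < scaleR k := by unfold scaleR; positivity
lemma one_le_scaleR (k : ℕ) : 1 ≤ scaleR k := one_le_pow₀ one_le_two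
lemma tendsto_scaleR_rpow {e : ℝ} (he : 0 < e) :
    Tendsto (fun k ↦ scaleR k ^ e) atTop atTop :=
  (tendsto_rpow_atTop he).comp (tendsto_pow_atTop_atTop_of_one_lt one_lt_two)
lemma scaleR_rpow (k : ℕ) (e : ℝ) : scaleR k ^ e = 2 ^ (e * k) := by
  rw [scaleR, ← Real.rpow_natCast, ← Real.rpow_mul (by norm_num), mul_comm]

variable (m : ℕ) (a : ℝ) (k : ℕ)

lemma scaleQ_mul_scaleD_sq :
    scaleQ (m + 1) a (1 / 2) k * scaleD (m + 1) a (1 / 2) k ^ 2 = scaleR k ^ (3 / 2 : ℝ) := by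
  have hR := scaleR_pos k
  rw [scaleQ, scaleD, ← Real.rpow_natCast (_ ^ _), ← Real.rpow_mul hR.le, ← Real.rpow_add hR]
  congr 1
  push_cast
  field_simp
  ring

lemma scaleQ_mul_scaleD_le (ha1 : a ≤ 1) :
    scaleQ (m + 1) a (1 / 2) k * scaleD (m + 1) a (1 / 2) k ≤ scaleR k := by
  have hR := scaleR_pos k
  rw [scaleQ, scaleD, ← Real.rpow_add hR]
  refine (Real.rpow_le_rpow_of_exponent_le (one_le_scaleR k) ?_).trans_eq (Real.rpow_one _)
  have hm : (0 : ℝ) ≤ m := Nat.cast_nonneg m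
  push_cast
  rw [div_mul_eq_mul_div, ← add_div, div_le_one (by positivity)]
  nlinarith

lemma one_div_scaleQ_sq_mul_scaleD_le (hm : 1 ≤ m) (ha : 3 / 4 < a) :
    1 / (scaleQ (m + 1) a (1 / 2) k ^ 2 * scaleD (m + 1) a (1 / 2) k) ≤ scaleR k ^ (-a) := by
  have hR := scaleR_pos k
  rw [scaleQ, scaleD, ← Real.rpow_natCast (_ ^ _), ← Real.rpow_mul hR.le, ← Real.rpow_add hR,
    one_div, ← Real.rpow_neg hR.le]
  refine Real.rpow_le_rpow_of_exponent_le (one_le_scaleR k) (neg_le_neg ?_)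
  have hm : (1 : ℝ) ≤ m := by exact_mod_cast hm
  push_cast
  rw [div_mul_eq_mul_div, div_mul_eq_mul_div, ← add_div, le_div_iff₀ (by positivity)]
  nlinarith

lemma one_div_scaleQ_mul_scaleD_eq (hm : 1 ≤ m) :
    1 / (scaleQ (m + 1) a (1 / 2) k * scaleD (m + 1) a (1 / 2) k) =
      scaleR k ^ (-a) * scaleQ (m + 1) a (1 / 2) k ^ ((m : ℝ)⁻¹) := by
  have hR := scaleR_pos k
  have hm : (0 : ℝ) < m := by exact_mod_cast hm
  rw [scaleQ, scaleD, ← Real.rpow_mul hR.le, ← Real.rpow_add hR, ← Real.rpow_add hR,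
    one_div, ← Real.rpow_neg hR.le]
  congr 1
  push_cast
  field_simp
  ring

lemma scaleQ_eq : scaleQ (m + 1) a (1 / 2) k =
    2 ^ ((m : ℝ) / (m + 2) * (2 * a - 3 / 2) * k) := by
  rw [scaleQ, scaleR_rpow]
  congr 2
  push_cast
  ring

lemma scaleQ_exponent_pos (hm : 1 ≤ m) (ha : 3 / 4 < a) :
    0 < (m : ℝ) / (m + 2) * (2 * a - 3 / 2) := by
  have hm : (0 : ℝ) < m := by exact_mod_cast hm
  exact mul_pos (by positivity) (by linarith)

lemma scaleQ_exponent_le_one (ha : 3 / 4 < a) (ha1 : a ≤ 1) :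
    (m : ℝ) / (m + 2) * (2 * a - 3 / 2) ≤ 1 := by
  have h1 : (m : ℝ) / (m + 2) ≤ 1 := by rw [div_le_one (by positivity)]; linarith
  have h0 : 0 ≤ (m : ℝ) / (m + 2) := by positivity
  nlinarith

lemma one_half_lt_scaleD_exponent (ha1 : a ≤ 1) : (1 : ℝ) / 2 <
    (((m + 1 : ℕ) : ℝ) - (((m + 1 : ℕ) : ℝ) - 1) * a + ((m + 1 : ℕ) : ℝ) * (1 / 2)) /
      (((m + 1 : ℕ) : ℝ) + 1) := by
  have hm : (0 : ℝ) ≤ m := Nat.cast_nonneg m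
  push_cast
  rw [lt_div_iff₀ (by positivity)]
  nlinarith

lemma one_le_scaleD (ha1 : a ≤ 1) : 1 ≤ scaleD (m + 1) a (1 / 2) k :=
  Real.one_le_rpow (one_le_scaleR k) (by linarith [one_half_lt_scaleD_exponent m a ha1])

lemma tendsto_scaleD (ha1 : a ≤ 1) : Tendsto (scaleD (m + 1) a (1 / 2)) atTop atTop :=
  tendsto_scaleR_rpow (by linarith [one_half_lt_scaleD_exponent m a ha1])

lemma tendsto_scaleD_sq_div (ha1 : a ≤ 1) :
    Tendsto (fun k ↦ scaleD (m + 1) a (1 / 2) k ^ 2 / (2 * scaleR k)) atTop atTop := by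
  have h := one_half_lt_scaleD_exponent m a ha1
  refine ((tendsto_scaleR_rpow (sub_pos.2 (by linarith :
    (1 : ℝ) < 2 * ((((m + 1 : ℕ) : ℝ) - (((m + 1 : ℕ) : ℝ) - 1) * a + ((m + 1 : ℕ) : ℝ) * (1 / 2)) /
      (((m + 1 : ℕ) : ℝ) + 1))))).atTop_div_const two_pos).congr fun k ↦ ?_
  have hR := scaleR_pos k
  rw [Real.rpow_sub hR, Real.rpow_one, scaleD, ← Real.rpow_natCast (_ ^ _), ← Real.rpow_mul hR.le,
    div_div, mul_comm (scaleR k)]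
  congr 2
  push_cast
  ring

end Scales

/-! ### Conclusion -/

/-- A continuous density on the cube `[0, c₀] ^ (m + 1)`. -/
noncomputable def cubeDensity {m : ℕ} (c₀ : ℝ) (x : Fin (m + 1) → ℝ) : ℝ :=
  ∏ i, tent ((x i - c₀ / 2) / (c₀ / 2))

/-- The cube `[0, c₀] ^ (m + 1)` as a product of intervals. -/
def piCube (m : ℕ) (c₀ : ℝ) : Set (Fin (m + 1) → ℝ) := Set.pi univ fun _ ↦ Icc 0 c₀

lemma isCompact_piCube (m : ℕ) (c₀ : ℝ) : IsCompact (piCube m c₀) :=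
  isCompact_univ_pi fun _ ↦ isCompact_Icc

lemma piCube_subset {m : ℕ} {c₀ : ℝ} (h : c₀ ≤ 1) : piCube m c₀ ⊆ piCube m 1 :=
  Set.pi_mono fun _ _ ↦ Icc_subset_Icc_right h

lemma continuous_cubeDensity {m : ℕ} (c₀ : ℝ) : Continuous (cubeDensity (m := m) c₀) :=
  continuous_finsetProd _ fun i _ ↦ continuous_tent.comp (by fun_prop)

lemma cubeDensity_nonneg {m : ℕ} (c₀ : ℝ) (x : Fin (m + 1) → ℝ) : 0 ≤ cubeDensity c₀ x :=
  Finset.prod_nonneg fun _ _ ↦ tent_nonneg _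

lemma cubeDensity_eq_zero {m : ℕ} {c₀ : ℝ} (h : 0 < c₀) {x : Fin (m + 1) → ℝ}
    (hx : x ∉ piCube m c₀) : cubeDensity c₀ x = 0 := by
  simp only [piCube, Set.mem_pi, mem_univ, forall_const, not_forall] at hx
  obtain ⟨i, hi⟩ := hx
  refine Finset.prod_eq_zero (Finset.mem_univ i) (tent_eq_zero ?_)
  rw [abs_div, abs_of_pos (half_pos h), one_le_div (half_pos h)]
  by_contra hlt
  rw [not_le, abs_lt] at hlt
  exact hi ⟨by linarith [hlt.1], by linarith [hlt.2]⟩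

lemma isCorrelationDensity_cubeDensity {m : ℕ} {c₀ : ℝ} (h : 0 < c₀) (h1 : c₀ ≤ 1) {s : ℝ}
    (hs : s ≤ m + 1) :
    IsCorrelationDensity volume (fun j ↦ tentKernel (4 * 2 ^ (-(j : ℝ)))) (piCube m c₀) 0
      (8 ^ (m + 1) + 1) s (cubeDensity c₀) (piCube m c₀) where
  continuous := continuous_cubeDensity c₀
  nonneg := cubeDensity_nonneg c₀
  isCompact := isCompact_piCube m c₀
  subset := Subset.rfl
  eq_zero := fun x hx ↦ cubeDensity_eq_zero h hx
  lt_mass := by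
    have hpos : 0 < ∫ x, cubeDensity (m := m) c₀ x := by
      refine (continuous_cubeDensity c₀).integral_pos_of_hasCompactSupport_nonneg_nonzero
        (x := fun _ ↦ c₀ / 2)
        (HasCompactSupport.intro (isCompact_piCube m c₀) fun x hx ↦ cubeDensity_eq_zero h hx)
        (cubeDensity_nonneg c₀) ?_
      simp [cubeDensity, tent]
    rw [integral_prod_mul]
    exact mul_pos hpos hpos
  correlation_lt := fun j ↦ by
    have hr : (0 : ℝ) < 2 ^ (-(j : ℝ)) := by positivity
    have hcont : Continuous fun x : ℝ ↦ tent ((x - c₀ / 2) / (c₀ / 2)) :=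
      continuous_tent.comp (by fun_prop)
    have heq := setIntegral_tentKernel_mul_prod (ι := Fin (m + 1)) (4 * 2 ^ (-(j : ℝ)))
      (u := fun _ x ↦ tent ((x - c₀ / 2) / (c₀ / 2)))
      (v := fun _ x ↦ tent ((x - c₀ / 2) / (c₀ / 2))) (fun _ ↦ hcont) (fun _ ↦ hcont)
    have hfull : ∫ p in piCube m 1 ×ˢ piCube m 1, tentKernel (4 * 2 ^ (-(j : ℝ))) p *
        (cubeDensity c₀ p.1 * cubeDensity c₀ p.2) =
        ∫ p : (Fin (m + 1) → ℝ) × (Fin (m + 1) → ℝ), tentKernel (4 * 2 ^ (-(j : ℝ))) p *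
          (cubeDensity c₀ p.1 * cubeDensity c₀ p.2) := by
      refine setIntegral_eq_integral_of_forall_compl_eq_zero fun p hp ↦ ?_
      rw [Set.mem_prod, not_and_or] at hp
      rcases hp with hp | hp <;>
        simp [cubeDensity_eq_zero h fun hx ↦ hp (piCube_subset h1 hx)]
    rw [← Measure.volume_eq_prod, ← hfull]
    refine lt_of_eq_of_lt heq ?_
    calc _ ≤ ∏ _i : Fin (m + 1), 1 * 1 * (2 * (4 * 2 ^ (-(j : ℝ)))) := by
          refine Finset.prod_le_prod (fun i _ ↦ integral_nonneg fun z ↦ mul_nonneg (tent_nonneg _)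
            (mul_nonneg (tent_nonneg _) (tent_nonneg _))) fun i _ ↦ ?_
          exact integral_tent_mul_le hcont hcont (fun _ ↦ tent_nonneg _) (fun _ ↦ tent_nonneg _)
            (fun _ ↦ tent_le_one _) (fun _ ↦ tent_le_one _) (by positivity)
      _ = 8 ^ (m + 1) * (2 : ℝ) ^ (-((m + 1 : ℝ) * j)) := by
          rw [Finset.prod_const, Finset.card_univ, Fintype.card_fin, one_mul, one_mul, ← mul_assoc,
            mul_pow, ← Real.rpow_natCast (2 ^ (-(j : ℝ))), ← Real.rpow_mul (by norm_num)]
          norm_num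
          rw [mul_comm]
      _ ≤ 8 ^ (m + 1) * (2 : ℝ) ^ (-(s * j)) := by
          gcongr
          norm_num
      _ < _ := by
          refine mul_lt_mul_of_pos_right (by linarith) (by positivity)

/-- The divergence set, up to the identification of `EuclideanSpace` with the product space, has
dimension at least every number less than `1 + m * a`. -/
theorem ofReal_le_dimH_divergenceSet {m : ℕ} (hm : 1 ≤ m) {a : ℝ} (ha : 3 / 4 < a) (ha1 : a ≤ 1)
    {c : ℝ} (hc : 0 < c) {c₀ : ℝ} (hc₀ : 0 < c₀) (hc₀1 : c₀ ≤ 1) {ε : ℝ} (hε : 0 < ε)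
    (hε1 : ε < 1) :
    ENNReal.ofReal (1 + m * a - 2 * ε) ≤
      dimH (divergenceSet (m + 1) a (1 / 2) c ∩ cube (m + 1) c₀) := by
  set κ : ℝ := (m : ℝ) / (m + 2) * (2 * a - 3 / 2) with hκdef
  have hκ : 0 < κ := scaleQ_exponent_pos m a hm ha
  have hκ1 : κ ≤ 1 := scaleQ_exponent_le_one m a ha ha1
  -- `c / 8` makes the tents fit into the slabs although `q` may be as small as `Q / 2`, and
  -- `1 / 4` keeps the tents around neighbouring fractions apart
  set c₁ : ℝ := min (c / 8) (1 / 4) with hc₁def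
  have hc₁ : 0 < c₁ := by positivity
  have hc₁4 : c₁ ≤ 1 / 4 := min_le_right _ _
  have hc₁c : 8 * c₁ ≤ c := by linarith [min_le_left (c / 8) (1 / 4)]
  have hQe (k : ℕ) : scaleQ (m + 1) a (1 / 2) k = 2 ^ (κ * k) := scaleQ_eq m a k
  have hQ1 (k : ℕ) : 1 ≤ scaleQ (m + 1) a (1 / 2) k := by
    rw [hQe]; exact Real.one_le_rpow one_le_two (by positivity)
  -- infinitely many generations with many primes
  set P : ℕ → Finset ℕ := fun k ↦ primesIoc (2 ^ (κ * ((k : ℝ) - 1))) (2 ^ (κ * k)) with hPdef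
  -- from some generation on the primes are odd, so that the parity conditions are void
  have hlarge : ∀ᶠ k : ℕ in atTop, (2 : ℝ) ≤ 2 ^ (κ * ((k : ℝ) - 1)) := by
    filter_upwards [eventually_ge_atTop ⌈1 + 1 / κ⌉₊] with k hk
    have h1 : 1 + 1 / κ ≤ k := Nat.ceil_le.1 hk
    have h2 : 1 ≤ κ * ((k : ℝ) - 1) := by
      have : 1 / κ ≤ (k : ℝ) - 1 := by linarith
      rw [div_le_iff₀ hκ] at this; linarith
    simpa using Real.rpow_le_rpow_of_exponent_le one_le_two h2
  obtain ⟨K, hKmono, hK⟩ := extraction_of_frequently_atTop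
    ((frequently_rpow_le_card_primesIoc hκ hε hε1).and_eventually hlarge)
  have hPmem (l : ℕ) : ∀ q ∈ P (K l), q.Prime ∧ 2 < q ∧
      scaleQ (m + 1) a (1 / 2) (K l) / 2 ≤ q ∧ (q : ℝ) ≤ scaleQ (m + 1) a (1 / 2) (K l) := by
    intro q hq
    obtain ⟨h1, h2, h3⟩ := (mem_primesIoc (by positivity)).1 hq
    rw [hQe]
    refine ⟨h1, by exact_mod_cast (hK l).2.trans_lt h2, le_trans ?_ h2.le, h3⟩
    rw [div_le_iff₀ two_pos]
    calc (2 : ℝ) ^ (κ * (K l)) = 2 ^ (κ * ((K l : ℝ) - 1)) * 2 ^ κ := by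
          rw [← Real.rpow_add two_pos]; congr 1; ring
      _ ≤ 2 ^ (κ * ((K l : ℝ) - 1)) * 2 := by
          gcongr
          simpa using Real.rpow_le_rpow_of_exponent_le (one_le_two (α := ℝ)) hκ1
  have hPc (l : ℕ) : scaleQ (m + 1) a (1 / 2) (K l) ^ (1 - ε) ≤ (P (K l)).card := by
    rw [hQe]; exact (hK l).1
  have hPne (l : ℕ) : (P (K l)).Nonempty := by
    rw [← Finset.card_pos]
    have : (0 : ℝ) < (P (K l)).card :=
      lt_of_lt_of_le (Real.rpow_pos_of_pos (by linarith [hQ1 (K l)]) _) (hPc l)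
    exact_mod_cast this
  -- the densities
  set R : ℕ → ℝ := fun l ↦ scaleR (K l) with hRdef
  set D : ℕ → ℝ := fun l ↦ scaleD (m + 1) a (1 / 2) (K l) with hDdef
  set t : ℕ → ℝ := fun l ↦ D l ^ 2 / (2 * R l) with htdef
  set w : ℕ → ℝ := fun l ↦ c₁ / R l with hwdef
  have hR0 (l : ℕ) : 0 < R l := scaleR_pos _
  have hD1 (l : ℕ) : 1 ≤ D l := one_le_scaleD m a _ ha1
  have hD0 (l : ℕ) : 0 < D l := by linarith [hD1 l]
  have ht0 (l : ℕ) : 0 < t l := by have := hR0 l; have := hD0 l; positivity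
  have hw0 (l : ℕ) : 0 < w l := div_pos hc₁ (hR0 l)
  have hδ : Tendsto (fun l ↦ max (t l)⁻¹ (D l)⁻¹) atTop (𝓝 0) := by
    have h1 : Tendsto (fun l ↦ (t l)⁻¹) atTop (𝓝 0) :=
      tendsto_inv_atTop_zero.comp ((tendsto_scaleD_sq_div m a ha1).comp hKmono.tendsto_atTop)
    have h2 : Tendsto (fun l ↦ (D l)⁻¹) atTop (𝓝 0) :=
      tendsto_inv_atTop_zero.comp ((tendsto_scaleD m a ha1).comp hKmono.tendsto_atTop)
    simpa using h1.max h2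
  have hav (l q : ℕ) (hq : q ∈ P (K l)) : IsAveraging (max (t l)⁻¹ (D l)⁻¹)
      (slabDensity (m := m) c₁ (t l) (D l) (w l) q) := by
    refine isAveraging_slabDensity hc₁ (by linarith) (ht0 l) (hD0 l) (hw0 l)
      (hPmem l q hq).1.two_le ?_ (le_max_left _ _) (le_max_right _ _)
    have h1 : (q : ℝ) * D l ≤ R l :=
      (mul_le_mul_of_nonneg_right (hPmem l q hq).2.2.2 (hD0 l).le).trans
        (scaleQ_mul_scaleD_le m a (K l) ha1)
    calc (q : ℝ) * D l * w l ≤ R l * w l := by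
          have := hw0 l; gcongr
      _ = c₁ := mul_div_cancel₀ _ (hR0 l).ne'
      _ ≤ 1 / 2 := by linarith
  set g : ℕ → (Fin (m + 1) → ℝ) → ℝ := fun l x ↦
    ((P (K l)).card : ℝ)⁻¹ * ∑ q ∈ P (K l), slabDensity c₁ (t l) (D l) (w l) q x with hgdef
  set E : ℕ → Set (Fin (m + 1) → ℝ) := fun l ↦
    slabSupport c₁ (t l) (D l) (w l) (P (K l)) with hEdef
  have hg0 (l : ℕ) (x : Fin (m + 1) → ℝ) : 0 ≤ g l x :=
    mul_nonneg (by positivity) (Finset.sum_nonneg fun q hq ↦ (hav l q hq).nonneg x)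
  have hgc (l : ℕ) : Continuous (g l) :=
    (continuous_finsetSum _ fun q hq ↦ (hav l q hq).continuous).const_mul _
  have hgE (l : ℕ) (x : Fin (m + 1) → ℝ) (hx : x ∉ E l) : g l x = 0 := by
    by_contra h
    exact hx (mem_slabSupport_of_sum_ne_zero hc₁ (hD0 l) (hw0 l)
      (fun q hq ↦ (hPmem l q hq).1.pos) (right_ne_zero_of_mul h))
  have hcor (l j : ℕ) : ∫ p in piCube m c₀ ×ˢ piCube m c₀,
      tentKernel (4 * 2 ^ (-(j : ℝ))) p * (g l p.1 * g l p.2) ∂volume.prod volume ≤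
      (64 / c₁ ^ 2 * (768 / c₁) ^ m * 4 ^ (1 + m * a - ε)) *
        2 ^ (-((1 + m * a - ε) * (j : ℝ))) := by
    have hr : (0 : ℝ) < 2 ^ (-(j : ℝ)) := by positivity
    have hr1 : (2 : ℝ) ^ (-(j : ℝ)) ≤ 1 :=
      Real.rpow_le_one_of_one_le_of_nonpos one_le_two (by simp)
    have h1 := setIntegral_average_slabDensity_le (t := t l) (ρ := 4 * 2 ^ (-(j : ℝ)))
      (by linarith) ha1 hc₁ (by linarith) hm (hR0 l) (hD1 l) (hQ1 (K l)) rfl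
      (scaleQ_mul_scaleD_le m a (K l) ha1) (one_div_scaleQ_sq_mul_scaleD_le m a (K l) hm ha)
      (one_div_scaleQ_mul_scaleD_eq m a (K l) hm).le (by positivity) (by linarith) hε.le hε1.le
      (fun q hq ↦ ⟨(hPmem l q hq).1, (hPmem l q hq).2.2.1⟩) (hPc l)
    rw [Real.mul_rpow (by norm_num) hr.le, ← Real.rpow_mul (by norm_num), ← mul_assoc,
      show -(j : ℝ) * (1 + m * a - ε) = -((1 + m * a - ε) * (j : ℝ)) by ring] at h1
    refine le_trans (setIntegral_mono_set ?_ ?_ ?_) h1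
    · refine ContinuousOn.integrableOn_compact ((isCompact_piCube m 1).prod (isCompact_piCube m 1))
        (Continuous.continuousOn ?_)
      exact (continuous_tentKernel _).mul
        (((hgc l).comp continuous_fst).mul ((hgc l).comp continuous_snd))
    · exact Eventually.of_forall fun p ↦
        mul_nonneg (tentKernel_nonneg _ _) (mul_nonneg (hg0 l _) (hg0 l _))
    · exact (Set.prod_mono (piCube_subset hc₀1) (piCube_subset hc₀1)).eventuallyLE
  have hmain := le_dimH_limsup_of_correlation (X := Fin (m + 1) → ℝ) volume
    (φ := fun j ↦ tentKernel (4 * 2 ^ (-(j : ℝ)))) (fun j ↦ continuous_tentKernel _)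
    (fun j p ↦ tentKernel_nonneg _ p) (κ := (1 / 2) ^ Fintype.card (Fin (m + 1))) (by positivity)
    (fun j p hp ↦ le_tentKernel_of_mem_nearPairs hp) (isCompact_piCube m c₀)
    (A := 8 ^ (m + 1) + 1) (s := 1 + m * a - 2 * ε) (s' := 1 + m * a - ε) (by positivity)
    (by linarith) (isCorrelationDensity_cubeDensity hc₀ hc₀1 (by nlinarith))
    (fun l ↦ isClosed_slabSupport c₁ (t l) (D l) (w l) (P (K l))) hgc hg0 hgE
    (fun F hF hFc ↦ tendsto_integral_mul_average volume (fun l ↦ P (K l)) hPne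
      (fun l q ↦ slabDensity c₁ (t l) (D l) (w l) q) hδ hav hF hFc) hcor
  refine hmain.trans ?_
  rw [← (EuclideanSpace.equiv (Fin (m + 1)) ℝ).symm.dimH_image]
  refine dimH_mono ?_
  rintro _ ⟨x, ⟨hxc, hxE⟩, rfl⟩
  refine ⟨Set.mem_iInter.2 fun N ↦ ?_, fun i ↦ hxc i (Set.mem_univ i)⟩
  obtain ⟨l, hl, hxl⟩ := Set.mem_iUnion₂.1 (Set.mem_iInter.1 hxE N)
  refine Set.mem_iUnion₂.2 ⟨K l, le_trans hl (hKmono.id_le l), ?_⟩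
  exact slabSupport_subset_levelSet hc₁ (by linarith) hc₁c (hD0 l) (by linarith [hQ1 (K l)])
    (scaleQ_mul_scaleD_sq m a (K l)) (hPmem l) hxl

end SchrodingerDivergence

theorem mainTheorem7 (n : ℕ) (hn : 2 ≤ n) (a b : ℝ) (ha : 3 / 4 < a) (ha' : a ≤ 1)
    (hb : b = 1 / 2) (c : ℝ) (hc : 0 < c) (c₀ : ℝ) (hc₀ : 0 < c₀) (hc₀' : c₀ ≤ 1) :
    ENNReal.ofReal (1 + ((n : ℝ) - 1) * a) ≤
      dimH (SchrodingerDivergence.divergenceSet n a b c ∩ SchrodingerDivergence.cube n c₀) := by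
  subst hb
  obtain ⟨m, rfl⟩ : ∃ m, n = m + 1 := ⟨n - 1, by omega⟩
  rw [Nat.cast_add, Nat.cast_one, add_sub_cancel_right]
  refine le_of_forall_lt fun d hd ↦ ?_
  have hdt : d ≠ ⊤ := hd.ne_top
  have hd' : d.toReal < 1 + m * a := (ENNReal.lt_ofReal_iff_toReal_lt hdt).1 hd
  have hmin : 0 < min (1 / 2) ((1 + m * a - d.toReal) / 4) := lt_min (by norm_num) (by linarith)
  refine lt_of_lt_of_le ?_ (SchrodingerDivergence.ofReal_le_dimH_divergenceSet
    (by omega : 1 ≤ m) ha ha' hc hc₀ hc₀' hmin ((min_le_left _ _).trans_lt (by norm_num)))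
  rw [ENNReal.lt_ofReal_iff_toReal_lt hdt]
  linarith [min_le_right (1 / 2) ((1 + m * a - d.toReal) / 4)]
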